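/- For complex $\alpha_1,\dots,\alpha_p$ and $\beta_1,\dots,\beta_q$, none of the $\beta_j$ in $\mathbb Z_{\le 0}=\{0,-1,-2,\dots\}$, write $${}_pF_q\biggl[\begin{matrix}\alpha_1,\dots,\alpha_p\\ \beta_1,\dots,\beta_q\end{matrix};z\biggr]=\sum_{k=0}^\infty\frac{(\alpha_1)_k\cdots(\alpha_p)_k}{(\beta_1)_k\cdots(\beta_q)_k\,k!}\,z^k,\qquad (x)_k=x(x+1)\cdots(x+k-1).$$ **(i)** Let $a,b,c\in\mathbb C$ satisfy $\operatorname{Re}(-3a+2b+2c)>0$ and $\operatorname{Re}(-2a+2b+2c+1)>0$. Assume that none of the lower parameters of the two series below, and none of the arguments of the Gamma functions in the numerators below, lies in $\mathbb Z_{\le0}$ (with $1/\Gamma(x)=0$ for $x\in\mathbb Z_{\le 0}$ in the denominators). Then both series converge absolutely and $${}_3F_2\biggl[\begin{matrix}a,\,b,\,c\\-a+2b+c,\,-a+b+2c\end{matrix};1\biggr] =\frac{\Gamma(-\frac a2+b+c+\frac12)\,\Gamma(-\frac{3a}2+2b+c+\frac12)}{\Gamma(-a+b+c+\frac12)\,\Gamma(-a+2b+c+\frac12)}$$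 $$\times\frac{\Gamma(-a+b+2c)\,\Gamma(-3a+2b+2c)\,\Gamma(-2a+2b+2c)\,\Gamma(-2a+4b+2c)}{\Gamma(-\frac{3a}2+b+2c)\,\Gamma(-\frac{5a}2+2b+2c)\,\Gamma(-a+2b+2c)\,\Gamma(-3a+4b+2c)}$$ $$\times{}_5F_4\biggl[\begin{matrix}-2a+2b+2c-1,\,c-\frac a2,\,-\frac{3a}2+b+c,\,\frac a2,\,b-\frac a2\\-\frac{3a}2+2b+c,\,-\frac a2+b+c,\,-\frac{5a}2+2b+2c,\,-\frac{3a}2+b+2c\end{matrix};1\biggr].$$ **(ii)** For every integer $n\ge0$ (the case $a=b=c=2n+1$ of (i)), $$\frac{\Gamma(4n+2)^2\,\Gamma(2n+1)^2}{\Gamma(3n+\frac32)^4}\,{}_5F_4\biggl[\begin{matrix}4n+1,\,n+\frac12,\,n+\frac12,\,n+\frac12,\,n+\frac12\\3n+\frac32,\,3n+\frac32,\,3n+\frac32,\,3n+\frac32\end{matrix};1\biggr]={}_3F_2\biggl[\begin{matrix}2n+1,\,2n+1,\,2n+1\\4n+2,\,4n+2\end{matrix};1\biggr].$$ Moreover the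 series $$r_n=\sum_{t=1}^\infty\frac{2^{8n}\,n!^4\,(2n)!^2\prod_{j=0}^{4n-1}(t-n+j)}{(4n)!\,\prod_{j=0}^{2n}(t-\frac12+j)^4}$$ converges absolutely and $$r_n=\frac{\pi^2\,\Gamma(2n+1)^6}{\Gamma(3n+\frac32)^4}\,{}_5F_4\biggl[\begin{matrix}4n+1,\,n+\frac12,\,n+\frac12,\,n+\frac12,\,n+\frac12\\3n+\frac32,\,3n+\frac32,\,3n+\frac32,\,3n+\frac32\end{matrix};1\biggr] =\frac{\pi^2(2n)!^4}{(4n+1)!^2}\,{}_3F_2\biggl[\begin{matrix}2n+1,\,2n+1,\,2n+1\\4n+2,\,4n+2\end{matrix};1\biggr]$$ $$=\pi^2\bigl(q_{2n}\,\zeta(2)-p_{2n}\bigr),$$ where $p_m/q_m$ are Apéry's approximations to $\zeta(2)$: $(q_m)$ and $(p_m)$ are the rational solutions of $(m+1)^2u_{m+1}=(11m^2+11m+3)u_m+m^2u_{m-1}$ ($m\ge1$) with $q_0=1$, $q_1=3$ and $p_0=0$, $p_1=5$. In particular $r_n\in\mathbb Q\pi^4+\mathbb Q\pi^2$. -/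

import Mathlib

noncomputable section

/-- The `k`-th term `(a₁)_k ⋯ (a_p)_k / ((b₁)_k ⋯ (b_q)_k k!) · z ^ k` of the generalized
hypergeometric series with upper parameters `as` and lower parameters `bs`. -/
def hypergeometricTerm (as bs : List ℂ) (z : ℂ) (k : ℕ) : ℂ :=
  (as.map fun x => (ascPochhammer ℂ k).eval x).prod /
    ((bs.map fun x => (ascPochhammer ℂ k).eval x).prod * (k.factorial : ℂ)) * z ^ k

/-- The generalized hypergeometric series `pFq[as; bs; z]`. -/
def hypergeometricF (as bs : List ℂ) (z : ℂ) : ℂ :=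
  ∑' k : ℕ, hypergeometricTerm as bs z k

/-- `x` is not one of `0, -1, -2, …`. -/
def NotNonposInt (x : ℂ) : Prop := ∀ m : ℕ, x ≠ -(m : ℂ)

/-- The rational function
`R_n(t) = 2^(8n) n!^4 (2n)!^2 ∏_{j=0}^{4n-1} (t-n+j) / ((4n)! ∏_{j=0}^{2n} (t-1/2+j)^4)`. -/
def wellPoisedR (n : ℕ) (t : ℂ) : ℂ :=
  (2 ^ (8 * n) * (n.factorial : ℂ) ^ 4 * ((2 * n).factorial : ℂ) ^ 2 *
      ∏ j ∈ Finset.range (4 * n), (t - n + j)) /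
    (((4 * n).factorial : ℂ) * ∏ j ∈ Finset.range (2 * n + 1), (t - 1 / 2 + j) ^ 4)

/-- `r_n = ∑_{t=1}^∞ R_n(t)`. -/
def wellPoisedForm (n : ℕ) : ℂ := ∑' t : ℕ, wellPoisedR n ((t : ℂ) + 1)

/-- The solution of Apéry's recurrence for `ζ(2)`,
`(m+1)² u_{m+1} = (11m² + 11m + 3) u_m + m² u_{m-1}` for `m ≥ 1`, with given `u_0`, `u_1`. -/
def aperySolution (u₀ u₁ : ℚ) : ℕ → ℚ
  | 0 => u₀
  | 1 => u₁
  | m + 2 =>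
    ((11 * ((m : ℚ) + 1) ^ 2 + 11 * ((m : ℚ) + 1) + 3) * aperySolution u₀ u₁ (m + 1) +
      ((m : ℚ) + 1) ^ 2 * aperySolution u₀ u₁ m) / ((m : ℚ) + 2) ^ 2

/-- Denominators of Apéry's approximations to `ζ(2)`: `1, 3, 19, 147, …`. -/
def aperyDen : ℕ → ℚ := aperySolution 1 3

/-- Numerators of Apéry's approximations to `ζ(2)`: `0, 5, 125/4, …`. -/
def aperyNum : ℕ → ℚ := aperySolution 0 5

end

/-! Put `h = b + c - a`, `y = a / 2`, `x = c - a / 2`. The ₃F₂ has upper parameters `2y, h - x + y,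
x + y` and lower ones `2h - x + y, h + x + y`. The ₅F₄ is well-poised: its upper parameters `2h - 1,
x, h - x, y, h - y` face the lower ones `2h - x, h + x, 2h - y, h + y`. The variables `x` and `y`
stay fixed and `h` is shifted by integers.

Each series is coupled to a contiguous companion by a pair of relations, `f(h) = α f(h+1) + β l(h)`
and `l(h) = γ f(h+1) + δ l(h+1)`. Multiplying the ₅F₄ and its companion by suitable Gamma quotients
gives exactly the coefficients of the ₃F₂ system (`threeTerm_relation`,
`threeTermCompanion_relation` and the two `gammaFactor` relations). All relations come from creative
telescoping with explicit polynomial certificates.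

Along `h + N` both series, both companions and both Gamma quotients tend to `1`. Hence the
determinant of the two solutions tends to `0`. It is multiplied by `αδ`, which tends to `-1/4`, when
passing from `N + 1` to `N`, so it vanishes for large `N`. The solutions are then proportional
there, with ratio `1` by the limits, and the recurrence carries equality down to `N = 0`
(`eq_of_linear_system`, `tsum_threeTerm_eq`). The duplication formula turns the resulting Gamma
quotient into the stated one.

For `a = b = c = 2n + 1` one has `h = 2n + 1`, `x = y = n + 1/2`. The first `n` summands of `r_n`
vanish and the others are a constant times the ₅F₄ terms (`wellPoisedR_add`). Up to a factor, the
₃F₂ is the value at `m = 2n` of a sequence of series which, by another telescoping certificate and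
two initial values, is `(-1)^m (q_m ζ(2) - p_m)` (`tsum_aperyTerm`). -/

section

open Filter Topology Asymptotics

/-! ### Pochhammer symbols -/

/-- The Pochhammer symbol `(a)_k = a (a + 1) ⋯ (a + k - 1)`. -/
noncomputable def poch (a : ℂ) (k : ℕ) : ℂ := (ascPochhammer ℂ k).eval a

theorem poch_succ (a : ℂ) (k : ℕ) : poch a (k + 1) = poch a k * (a + k) :=
  ascPochhammer_succ_eval k a

theorem poch_succ_left (a : ℂ) (k : ℕ) : poch a (k + 1) = a * poch (a + 1) k := by
  simp [poch, ascPochhammer_succ_left]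

theorem prod_range_add_eq_poch (a : ℂ) (n : ℕ) :
    ∏ j ∈ Finset.range n, (a + j) = poch a n := by
  induction n with
  | zero => simp [poch]
  | succ n ih => rw [Finset.prod_range_succ, ih, poch_succ]

theorem NotNonposInt.add_natCast {a : ℂ} (ha : NotNonposInt a) (n : ℕ) :
    NotNonposInt (a + n) := fun m h => ha (n + m) (by push_cast; linear_combination h)

theorem NotNonposInt.add_ne_zero {a : ℂ} (ha : NotNonposInt a) (n : ℕ) : a + n ≠ 0 :=
  fun h => ha n (by linear_combination h)

theorem NotNonposInt.ne_zero {a : ℂ} (ha : NotNonposInt a) : a ≠ 0 := by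
  simpa using ha 0

theorem notNonposInt_of_re_pos {a : ℂ} (ha : 0 < a.re) : NotNonposInt a := by
  rintro m rfl
  have : (0 : ℝ) ≤ m := m.cast_nonneg
  simp at ha
  linarith

theorem poch_ne_zero {a : ℂ} (ha : NotNonposInt a) (k : ℕ) : poch a k ≠ 0 := by
  rw [← prod_range_add_eq_poch, Finset.prod_ne_zero_iff]
  exact fun j _ => ha.add_ne_zero j

theorem inv_GammaSeq (a : ℂ) (n : ℕ) :
    (Complex.GammaSeq a n)⁻¹ = poch a (n + 1) / ((n : ℂ) ^ a * n.factorial) := by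
  rw [Complex.GammaSeq, inv_div, prod_range_add_eq_poch]

/-- Inverted Euler limit. It survives at the poles, where `Complex.Gamma` takes the value `0` and
the Pochhammer symbol vanishes for large `n`; this leaves the upper parameters unrestricted. -/
theorem tendsto_poch_div (a : ℂ) :
    Tendsto (fun n : ℕ => poch a (n + 1) / ((n : ℂ) ^ a * n.factorial)) atTop
      (𝓝 (Complex.Gamma a)⁻¹) := by
  by_cases ha : Complex.Gamma a = 0
  · obtain ⟨m, rfl⟩ := (Complex.Gamma_eq_zero_iff a).1 ha
    rw [ha, inv_zero]
    refine tendsto_const_nhds.congr' ?_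
    filter_upwards [eventually_ge_atTop m] with n hn
    rw [← prod_range_add_eq_poch,
      Finset.prod_eq_zero (Finset.mem_range.2 (Nat.lt_succ_of_le hn)) (by simp), zero_div]
  · simpa only [← inv_GammaSeq] using (Complex.GammaSeq_tendsto_Gamma a).inv₀ ha

theorem tendsto_prod_poch_div (as : List ℂ) :
    Tendsto (fun n : ℕ => (as.map fun a => poch a (n + 1)).prod /
      ((n : ℂ) ^ as.sum * (n.factorial : ℂ) ^ as.length)) atTop
      (𝓝 (as.map fun a => (Complex.Gamma a)⁻¹).prod) := by
  induction as with
  | nil => simp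
  | cons a as ih =>
    simp only [List.map_cons, List.prod_cons, List.sum_cons, List.length_cons]
    refine ((tendsto_poch_div a).mul ih).congr' ?_
    filter_upwards [eventually_gt_atTop 0] with n hn
    rw [Complex.cpow_add _ _ (by exact_mod_cast hn.ne')]
    ring

/-! ### Growth of hypergeometric terms -/

/-- Quotient of the Euler limits of the upper and lower Pochhammer products; the limit below is
nonzero. With one more upper parameter a single `n!` is left over the `(n + 1)!` of the term, which
lowers the exponent by one. -/
theorem hypergeometricTerm_succ_isBigO {as bs : List ℂ} (hlen : as.length = bs.length + 1)
    (hbs : ∀ b ∈ bs, NotNonposInt b) :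
    (fun n : ℕ => hypergeometricTerm as bs 1 (n + 1)) =O[atTop]
      fun n : ℕ => (n : ℝ) ^ ((as.sum - bs.sum).re - 1) := by
  have hne : (bs.map fun b => (Complex.Gamma b)⁻¹).prod ≠ 0 := by
    refine List.prod_ne_zero ?_
    intro h
    obtain ⟨b, hb, h0⟩ := List.mem_map.1 h
    exact inv_ne_zero (Complex.Gamma_ne_zero (hbs b hb)) h0
  have hlim := ((tendsto_prod_poch_div as).div (tendsto_prod_poch_div bs) hne)
  have h1 := hlim.isBigO_one ℝ
  have h2 : (fun n : ℕ => (n : ℂ) ^ (as.sum - bs.sum) / ((n : ℂ) + 1)) =O[atTop]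
      fun n : ℕ => (n : ℝ) ^ ((as.sum - bs.sum).re - 1) := by
    refine IsBigO.of_bound 1 ?_
    filter_upwards [eventually_gt_atTop 0] with n hn
    have hn' : (0 : ℝ) < n := by exact_mod_cast hn
    have h3 : ‖(n : ℂ) + 1‖ = (n : ℝ) + 1 := by
      have : ((n : ℂ) + 1) = ((n + 1 : ℕ) : ℂ) := by push_cast; ring
      rw [this, Complex.norm_natCast]; push_cast; ring
    rw [norm_div, h3, Complex.norm_natCast_cpow_of_pos hn, one_mul,
      Real.norm_of_nonneg (by positivity), Real.rpow_sub_one hn'.ne']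
    gcongr
    linarith
  have h3 := h1.mul h2
  simp only [one_mul] at h3
  refine (h3.congr' ?_ EventuallyEq.rfl)
  filter_upwards [eventually_gt_atTop 0] with n hn
  have hn' : (n : ℂ) ≠ 0 := by exact_mod_cast hn.ne'
  have hn1 : (n : ℂ) + 1 ≠ 0 := by exact_mod_cast n.succ_ne_zero
  have hf : (n.factorial : ℂ) ≠ 0 := by exact_mod_cast n.factorial_ne_zero
  have ha : (n : ℂ) ^ as.sum ≠ 0 := by simp [Complex.cpow_eq_zero_iff, hn']
  have hb : (n : ℂ) ^ bs.sum ≠ 0 := by simp [Complex.cpow_eq_zero_iff, hn']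
  have hp : (bs.map fun b => poch b (n + 1)).prod ≠ 0 := by
    refine List.prod_ne_zero ?_
    intro h
    obtain ⟨b, hb, h0⟩ := List.mem_map.1 h
    exact poch_ne_zero (hbs b hb) _ h0
  simp only [poch] at hp
  simp only [hypergeometricTerm, poch, Pi.div_apply, one_pow, mul_one, Nat.factorial_succ,
    Complex.cpow_sub _ _ hn', hlen, pow_succ]
  push_cast
  field_simp

theorem summable_hypergeometricTerm {as bs : List ℂ} (hlen : as.length = bs.length + 1)
    (hbs : ∀ b ∈ bs, NotNonposInt b) (hs : 0 < (bs.sum - as.sum).re) :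
    Summable (hypergeometricTerm as bs 1) := by
  rw [← summable_nat_add_iff 1]
  refine summable_of_isBigO_nat (Real.summable_nat_rpow.2 ?_)
    (hypergeometricTerm_succ_isBigO hlen hbs)
  simp only [Complex.sub_re] at hs ⊢
  linarith

/-- Kills the boundary terms of the telescoping sums, whose certificates are polynomials in `n + 1`
times a hypergeometric term. -/
theorem tendsto_hypergeometricTerm_mul_pow {as bs : List ℂ}
    (hlen : as.length = bs.length + 1) (hbs : ∀ b ∈ bs, NotNonposInt b) (i : ℕ)
    (hs : (i : ℝ) < (bs.sum - as.sum).re + 1) :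
    Tendsto (fun n : ℕ => hypergeometricTerm as bs 1 n * ((n : ℂ) + 1) ^ i) atTop (𝓝 0) := by
  rw [← tendsto_add_atTop_iff_nat 1]
  have h1 : (fun n : ℕ => (((n + 1 : ℕ) : ℂ) + 1) ^ i) =O[atTop] fun n : ℕ => (n : ℝ) ^ (i : ℝ) := by
    refine IsBigO.of_bound (3 ^ i) ?_
    filter_upwards [eventually_gt_atTop 0] with n hn
    have hn' : (1 : ℝ) ≤ n := by exact_mod_cast hn
    have h3 : ‖((n + 1 : ℕ) : ℂ) + 1‖ = (n : ℝ) + 2 := by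
      have : (((n + 1 : ℕ) : ℂ) + 1) = ((n + 2 : ℕ) : ℂ) := by push_cast; ring
      rw [this, Complex.norm_natCast]; push_cast; ring
    rw [norm_pow, h3, Real.rpow_natCast, norm_pow, ← mul_pow, Real.norm_of_nonneg (by positivity)]
    gcongr
    linarith
  refine ((hypergeometricTerm_succ_isBigO hlen hbs).mul h1).trans_tendsto ?_
  have h2 : Tendsto (fun n : ℕ => (n : ℝ) ^ (-((bs.sum - as.sum).re + 1 - i))) atTop (𝓝 0) :=
    (tendsto_rpow_neg_atTop (by linarith)).comp tendsto_natCast_atTop_atTop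
  refine h2.congr' ?_
  filter_upwards [eventually_gt_atTop 0] with n hn
  have hn' : (0 : ℝ) < n := by exact_mod_cast hn
  rw [← Real.rpow_add hn']
  congr 1
  simp only [Complex.sub_re]
  ring

/-! ### Telescoping, and linear systems with a common dominant solution -/

/-- Creative telescoping. The case of index `0` is separate because it plays the role of `V (-1) =
0`. -/
theorem tsum_eq_of_telescoping {t₀ t₁ t₂ V : ℕ → ℂ} {p a b : ℂ} (h₀ : Summable t₀)
    (h₁ : Summable t₁) (h₂ : Summable t₂) (hV : Tendsto V atTop (𝓝 0))
    (hz : p * t₀ 0 = a * t₁ 0 + b * t₂ 0 - V 0)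
    (hs : ∀ j, p * t₀ (j + 1) = a * t₁ (j + 1) + b * t₂ (j + 1) - (V (j + 1) - V j)) :
    p * ∑' k, t₀ k = a * ∑' k, t₁ k + b * ∑' k, t₂ k := by
  have key : ∀ n, p * ∑ k ∈ Finset.range (n + 1), t₀ k =
      a * ∑ k ∈ Finset.range (n + 1), t₁ k + b * ∑ k ∈ Finset.range (n + 1), t₂ k - V n := by
    intro n
    induction n with
    | zero => simpa using hz
    | succ n ih =>
      simp only [Finset.sum_range_succ _ (n + 1), mul_add, ih, hs]
      ring
  have l (t : ℕ → ℂ) (ht : Summable t) :=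
    (tendsto_add_atTop_iff_nat 1).2 ht.hasSum.tendsto_sum_nat
  refine tendsto_nhds_unique ((l t₀ h₀).const_mul p) ?_
  have := (((l t₁ h₁).const_mul a).add ((l t₂ h₂).const_mul b)).sub hV
  rw [sub_zero] at this
  exact this.congr fun n => (key n).symm

/-- Reduces one telescoping step to a polynomial identity. The terms at index `j + 1` are all
compared with the base term `T` at index `j`, with `J = j + 1`; the cofactors `sᵢ` complete the
denominators to the common `D`, up to the factors `gᵢ`, which are absorbed in the coefficients `p`,
`a`, `b`. -/
theorem telescoping_step {p a b c t₀ t₁ t₂ T T' q q' D J : ℂ}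
    {C₀ C₁ C₂ R₀ R₁ R₂ R₃ s₀ s₁ s₂ g₀ g₁ g₂ n₀ n₁ n₂ : ℂ} (hD : D ≠ 0) (hJ : J ≠ 0)
    (e₀ : C₀ * J * t₀ = T * R₀) (e₁ : C₁ * J * t₁ = T * R₁) (e₂ : C₂ * J * t₂ = T * R₂)
    (e₃ : D * J * T' = T * R₃)
    (hs₀ : s₀ * C₀ = g₀ * D) (hs₁ : s₁ * C₁ = g₁ * D) (hs₂ : s₂ * C₂ = g₂ * D)
    (hp : n₀ * g₀ = p) (ha : n₁ * g₁ = a) (hb : n₂ * g₂ = b)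
    (key : n₀ * s₀ * R₀ = n₁ * s₁ * R₁ + n₂ * s₂ * R₂ - c * (q' * R₃ - q * D * J)) :
    p * t₀ = a * t₁ + b * t₂ - (c * (q' * T') - c * (q * T)) := by
  subst hp ha hb
  refine mul_left_cancel₀ (mul_ne_zero hD hJ) ?_
  linear_combination n₀ * s₀ * e₀ - n₁ * s₁ * e₁ - n₂ * s₂ * e₂ + c * q' * e₃ + T * key
    - n₀ * J * t₀ * hs₀ + n₁ * J * t₁ * hs₁ + n₂ * J * t₂ * hs₂

/-- After cancelling `c`, the identity reads `D * A = X * B`. Since `D` and `X` are generically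
coprime, it splits as `A = X * w`, `B = D * w` for a polynomial `w`, two identities of much lower
degree. Here the `R₁` term belongs to `A`. -/
theorem telescoping_key_left {c q q' D J X w z n₀ n₁ n₂ R₀ R₁ R₂ R₃ M₀ M₁ u v y₂ : ℂ}
    (hR₀ : R₀ = c * M₀) (hR₁ : R₁ = c * M₁) (hR₂ : R₂ = u * (X * y₂)) (hR₃ : R₃ = X * z)
    (hu : n₂ * u = c * v) (hA : n₀ * M₀ = n₁ * M₁ + X * w + q * J)
    (hB : v * y₂ = q' * z + D * w) :
    n₀ * D * R₀ = n₁ * D * R₁ + n₂ * 1 * R₂ - c * (q' * R₃ - q * D * J) := by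
  subst hR₀ hR₁ hR₂ hR₃
  linear_combination c * D * hA - X * y₂ * hu - c * X * hB

/-- The same splitting when `R₁` is divisible by `X`, so that its term belongs to `B`. -/
theorem telescoping_key_right {c q q' D J X w z n₀ n₁ n₂ R₀ R₁ R₂ R₃ M₀ u v y₁ y₂ s : ℂ}
    (hR₀ : R₀ = c * M₀) (hR₁ : R₁ = c * (X * y₁)) (hR₂ : R₂ = u * (X * y₂)) (hR₃ : R₃ = X * z)
    (hu : n₂ * u = c * v) (hA : n₀ * M₀ = X * w + q * J)
    (hB : n₁ * y₁ + s * v * y₂ = q' * z + D * w) :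
    n₀ * D * R₀ = n₁ * 1 * R₁ + n₂ * s * R₂ - c * (q' * R₃ - q * D * J) := by
  subst hR₀ hR₁ hR₂ hR₃
  linear_combination c * D * hA - s * X * y₂ * hu - c * X * hB

/-- Two solutions `(f, l)` and `(u, v)` of the same system of first-order linear recurrences,
whose determinant is eventually at most `1` in norm, coincide if all their components
tend to `1`. -/
theorem eq_of_linear_system {f l u v α β γ δ : ℕ → ℂ}
    (hf : ∀ n, f n = α n * f (n + 1) + β n * l n)
    (hl : ∀ n, l n = γ n * f (n + 1) + δ n * l (n + 1))
    (hu : ∀ n, u n = α n * u (n + 1) + β n * v n)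
    (hv : ∀ n, v n = γ n * u (n + 1) + δ n * v (n + 1))
    (hdet : ∀ᶠ n in atTop, ‖α n * δ n‖ ≤ 1)
    (lf : Tendsto f atTop (𝓝 1)) (ll : Tendsto l atTop (𝓝 1))
    (lu : Tendsto u atTop (𝓝 1)) (lv : Tendsto v atTop (𝓝 1)) (n : ℕ) : f n = u n := by
  -- The Casoratian of the two solutions: it picks up only the factor `α n * δ n`, the `β` and `γ`
  -- parts cancelling.
  have hW : ∀ n, f n * v n - l n * u n =
      α n * δ n * (f (n + 1) * v (n + 1) - l (n + 1) * u (n + 1)) := by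
    intro n
    rw [hf n, hu n, hl n, hv n]
    ring
  have lW : Tendsto (fun n => ‖f n * v n - l n * u n‖) atTop (𝓝 0) := by
    simpa using ((lf.mul lv).sub (ll.mul lu)).norm
  obtain ⟨N₀, hN₀⟩ := eventually_atTop.1 hdet
  obtain ⟨N₁, hN₁⟩ := eventually_atTop.1
    ((lu.eventually_ne one_ne_zero).and (lv.eventually_ne one_ne_zero))
  set N := max N₀ N₁ with hN
  -- The norm does not decrease with the index beyond `N`, yet it tends to `0`, so the Casoratian
  -- vanishes from `N` on.
  have hmono : ∀ n, N ≤ n → ∀ m, ‖f n * v n - l n * u n‖ ≤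
      ‖f (m + n) * v (m + n) - l (m + n) * u (m + n)‖ := by
    intro n hn m
    induction m with
    | zero => simp
    | succ m ih =>
      refine ih.trans ?_
      rw [hW (m + n), norm_mul, show m + 1 + n = m + n + 1 by ring]
      exact mul_le_of_le_one_left (norm_nonneg _) (hN₀ _ (by omega))
  have hW0 : ∀ n, N ≤ n → f n * v n = l n * u n := by
    intro n hn
    have := ge_of_tendsto' ((tendsto_add_atTop_iff_nat n).2 lW) (hmono n hn)
    exact sub_eq_zero.1 (norm_le_zero_iff.1 this)
  have hratio : ∀ n, N ≤ n → f n / u n = f (n + 1) / u (n + 1) := by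
    intro n hn
    have hu0 := (hN₁ n (by omega)).1
    have hu1 := (hN₁ (n + 1) (by omega)).1
    have h1 := hW0 (n + 1) (by omega)
    -- Mixed form of the vanishing Casoratian at `n + 1`; with it the `β` terms match and the ratio
    -- `f / u` is constant.
    have e1 : l n * u (n + 1) = v n * f (n + 1) := by
      rw [hl n, hv n]
      linear_combination -(δ n) * h1
    rw [div_eq_div_iff hu0 hu1, hf n, hu n]
    linear_combination β n * e1
  have hone : ∀ n, N ≤ n → f n = u n := by
    intro n hn
    have hc : ∀ m, f (m + n) / u (m + n) = f n / u n := by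
      intro m
      induction m with
      | zero => simp
      | succ m ih => rw [← ih, hratio (m + n) (by omega), show m + 1 + n = m + n + 1 by ring]
    have h1 : Tendsto (fun m => f (m + n) / u (m + n)) atTop (𝓝 1) := by
      simpa using ((tendsto_add_atTop_iff_nat n).2 (lf.div lu one_ne_zero))
    simp only [hc] at h1
    exact (div_eq_one_iff_eq (hN₁ n (by omega)).1).1 (tendsto_nhds_unique tendsto_const_nhds h1)
  have htop : ∀ n, N ≤ n → l n = v n := by
    intro n hn
    have h := hW0 n hn
    rw [hone n hn, mul_comm] at h
    exact (mul_right_cancel₀ (hN₁ n (by omega)).1 h).symm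
  -- The recurrences express index `n` through `n + 1`, so equality descends without division, even
  -- where `u` or `v` vanishes.
  have hdown : ∀ m n, N ≤ n + m → f n = u n ∧ l n = v n := by
    intro m
    induction m with
    | zero => exact fun n hn => ⟨hone n hn, htop n hn⟩
    | succ m ih =>
      intro n hn
      obtain ⟨h1, h2⟩ := ih (n + 1) (by omega)
      have h3 : l n = v n := by rw [hl n, hv n, h1, h2]
      exact ⟨by rw [hf n, hu n, h1, h3], h3⟩
  exact (hdown N n (by omega)).1

/-! ### The series and their companions -/

theorem hypergeometricTerm_three_two (a b c d e : ℂ) (k : ℕ) :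
    hypergeometricTerm [a, b, c] [d, e] 1 k =
      poch a k * poch b k * poch c k / (poch d k * poch e k * k.factorial) := by
  simp [hypergeometricTerm, poch, mul_assoc]

theorem hypergeometricTerm_five_four (a b c d e f g i l : ℂ) (k : ℕ) :
    hypergeometricTerm [a, b, c, d, e] [f, g, i, l] 1 k =
      poch a k * poch b k * poch c k * poch d k * poch e k /
        (poch f k * poch g k * poch i k * poch l k * k.factorial) := by
  simp [hypergeometricTerm, poch, mul_assoc]

theorem hypergeometricTerm_zero (as bs : List ℂ) (z : ℂ) : hypergeometricTerm as bs z 0 = 1 := by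
  simp [hypergeometricTerm]

/-- Here and in the next three lemmas, a parameter at index `k + 1` is compared with a base
parameter at index `k`, in the uniform shape `poch A (k + 1) * c = poch a k * r`. The base parameter
exceeds the given one by `1`, `0`, `-1`, `2` respectively. -/
theorem poch_succ_eq_left {a b : ℂ} (k : ℕ) (h : b = a + 1) :
    poch a (k + 1) * 1 = poch b k * a := by
  rw [poch_succ_left, h, mul_one, mul_comm]

theorem poch_succ_eq_right {a b : ℂ} (k : ℕ) (h : b = a) :
    poch b (k + 1) * 1 = poch a k * (a + k) := by
  rw [h, poch_succ, mul_one]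

theorem poch_succ_eq_add_one {a b : ℂ} (k : ℕ) (h : b = a + 1) :
    poch b (k + 1) * a = poch a k * ((a + k) * (a + k + 1)) := by
  rw [h, mul_comm, ← poch_succ_left, poch_succ, poch_succ]
  push_cast
  ring

theorem poch_succ_eq_add_two {a b : ℂ} (k : ℕ) (h : b = a + 2) :
    poch a (k + 1) * (a + 1 + k) = poch b k * (a * (a + 1)) := by
  rw [h, poch_succ_left, mul_assoc, ← poch_succ, poch_succ_left, add_assoc a, one_add_one_eq_two]
  ring

/-- Multiplies the parameterwise comparisons into a ratio between a term at `j + 1` and a contiguous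
base term at `j`, kept free of division so that the linear factors may vanish. -/
theorem hypergeometricTerm_three_two_succ {A₁ A₂ A₃ B₁ B₂ a₁ a₂ a₃ b₁ b₂ : ℂ}
    {c₁ c₂ c₃ r₁ r₂ r₃ s₁ s₂ t₁ t₂ : ℂ} {j : ℕ}
    (nB₁ : NotNonposInt B₁) (nB₂ : NotNonposInt B₂) (nb₁ : NotNonposInt b₁)
    (nb₂ : NotNonposInt b₂)
    (u₁ : poch A₁ (j + 1) * c₁ = poch a₁ j * r₁) (u₂ : poch A₂ (j + 1) * c₂ = poch a₂ j * r₂)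
    (u₃ : poch A₃ (j + 1) * c₃ = poch a₃ j * r₃)
    (l₁ : poch B₁ (j + 1) * s₁ = poch b₁ j * t₁) (l₂ : poch B₂ (j + 1) * s₂ = poch b₂ j * t₂) :
    c₁ * c₂ * c₃ * (t₁ * t₂) * (j + 1) * hypergeometricTerm [A₁, A₂, A₃] [B₁, B₂] 1 (j + 1) =
      hypergeometricTerm [a₁, a₂, a₃] [b₁, b₂] 1 j * (r₁ * r₂ * r₃ * (s₁ * s₂)) := by
  have hf : (((j + 1).factorial : ℕ) : ℂ) = (j + 1) * (j.factorial : ℂ) := by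
    rw [Nat.factorial_succ]; push_cast; ring
  have aj : (j : ℂ) + 1 ≠ 0 := by exact_mod_cast j.succ_ne_zero
  have af : (j.factorial : ℂ) ≠ 0 := by exact_mod_cast j.factorial_ne_zero
  rw [hypergeometricTerm_three_two, hypergeometricTerm_three_two, hf, mul_div_assoc',
    div_mul_eq_mul_div, div_eq_div_iff (by simp [poch_ne_zero, *]) (by simp [poch_ne_zero, *])]
  calc _ = (poch A₁ (j + 1) * c₁) * (poch A₂ (j + 1) * c₂) * (poch A₃ (j + 1) * c₃) *
        ((poch b₁ j * t₁) * (poch b₂ j * t₂)) * (j + 1) * j.factorial := by ring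
    _ = _ := by rw [u₁, u₂, u₃, ← l₁, ← l₂]; ring

theorem hypergeometricTerm_five_four_succ {A₁ A₂ A₃ A₄ A₅ B₁ B₂ B₃ B₄ : ℂ}
    {a₁ a₂ a₃ a₄ a₅ b₁ b₂ b₃ b₄ : ℂ}
    {c₁ c₂ c₃ c₄ c₅ r₁ r₂ r₃ r₄ r₅ s₁ s₂ s₃ s₄ t₁ t₂ t₃ t₄ : ℂ} {j : ℕ}
    (nB₁ : NotNonposInt B₁) (nB₂ : NotNonposInt B₂) (nB₃ : NotNonposInt B₃)
    (nB₄ : NotNonposInt B₄) (nb₁ : NotNonposInt b₁) (nb₂ : NotNonposInt b₂)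
    (nb₃ : NotNonposInt b₃) (nb₄ : NotNonposInt b₄)
    (u₁ : poch A₁ (j + 1) * c₁ = poch a₁ j * r₁) (u₂ : poch A₂ (j + 1) * c₂ = poch a₂ j * r₂)
    (u₃ : poch A₃ (j + 1) * c₃ = poch a₃ j * r₃) (u₄ : poch A₄ (j + 1) * c₄ = poch a₄ j * r₄)
    (u₅ : poch A₅ (j + 1) * c₅ = poch a₅ j * r₅)
    (l₁ : poch B₁ (j + 1) * s₁ = poch b₁ j * t₁) (l₂ : poch B₂ (j + 1) * s₂ = poch b₂ j * t₂)
    (l₃ : poch B₃ (j + 1) * s₃ = poch b₃ j * t₃) (l₄ : poch B₄ (j + 1) * s₄ = poch b₄ j * t₄) :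
    c₁ * c₂ * c₃ * c₄ * c₅ * (t₁ * t₂ * t₃ * t₄) * (j + 1) *
        hypergeometricTerm [A₁, A₂, A₃, A₄, A₅] [B₁, B₂, B₃, B₄] 1 (j + 1) =
      hypergeometricTerm [a₁, a₂, a₃, a₄, a₅] [b₁, b₂, b₃, b₄] 1 j *
        (r₁ * r₂ * r₃ * r₄ * r₅ * (s₁ * s₂ * s₃ * s₄)) := by
  have hf : (((j + 1).factorial : ℕ) : ℂ) = (j + 1) * (j.factorial : ℂ) := by
    rw [Nat.factorial_succ]; push_cast; ring
  have aj : (j : ℂ) + 1 ≠ 0 := by exact_mod_cast j.succ_ne_zero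
  have af : (j.factorial : ℂ) ≠ 0 := by exact_mod_cast j.factorial_ne_zero
  rw [hypergeometricTerm_five_four, hypergeometricTerm_five_four, hf, mul_div_assoc',
    div_mul_eq_mul_div, div_eq_div_iff (by simp [poch_ne_zero, *]) (by simp [poch_ne_zero, *])]
  calc _ = (poch A₁ (j + 1) * c₁) * (poch A₂ (j + 1) * c₂) * (poch A₃ (j + 1) * c₃) *
        (poch A₄ (j + 1) * c₄) * (poch A₅ (j + 1) * c₅) *
        ((poch b₁ j * t₁) * (poch b₂ j * t₂) * (poch b₃ j * t₃) * (poch b₄ j * t₄)) *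
        (j + 1) * j.factorial := by ring
    _ = _ := by rw [u₁, u₂, u₃, u₄, u₅, ← l₁, ← l₂, ← l₃, ← l₄]; ring

/-- The terms of the `₃F₂` series. -/
noncomputable def threeTerm (h x y : ℂ) : ℕ → ℂ :=
  hypergeometricTerm [2 * y, h - x + y, x + y] [2 * h - x + y, h + x + y] 1

/-- The terms of a `₃F₂` series contiguous to `threeTerm`. -/
noncomputable def threeTermCompanion (h x y : ℂ) : ℕ → ℂ :=
  hypergeometricTerm [2 * y + 1, h - x + y + 1, x + y] [2 * h - x + y + 2, h + x + y + 1] 1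

/-- The terms of the well-poised `₅F₄` series. -/
noncomputable def fiveTerm (h x y : ℂ) : ℕ → ℂ :=
  hypergeometricTerm [2 * h - 1, x, h - x, y, h - y] [2 * h - x, h + x, 2 * h - y, h + y] 1

/-- The terms of a well-poised `₅F₄` series contiguous to `fiveTerm`. -/
noncomputable def fiveTermCompanion (h x y : ℂ) : ℕ → ℂ :=
  hypergeometricTerm [2 * h + 1, x, h - x + 1, y + 1, h - y + 1]
    [2 * h - x + 2, h + x + 1, 2 * h - y + 1, h + y + 1] 1

/-- The conditions under which the transformation holds. -/
structure Admissible (h x y : ℂ) : Prop where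
  re_sub : 0 < (h - y).re
  re_half : 0 < (2 * h + 1).re
  ne_zero : h ≠ 0
  twoSubAdd : NotNonposInt (2 * h - x + y)
  addAdd : NotNonposInt (h + x + y)
  twoSub_left : NotNonposInt (2 * h - x)
  add_left : NotNonposInt (h + x)
  twoSub_right : NotNonposInt (2 * h - y)
  add_right : NotNonposInt (h + y)

theorem NotNonposInt.of_eq_add {a b : ℂ} (ha : NotNonposInt a) (n : ℕ) (h : b = a + n) :
    NotNonposInt b := h ▸ ha.add_natCast n

namespace Admissible

variable {h x y : ℂ}

theorem add_one (H : Admissible h x y) : Admissible (h + 1) x y where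
  re_sub := by have := H.re_sub; simp at this ⊢; linarith
  re_half := by have := H.re_half; simp at this ⊢; linarith
  -- `h = -1` is excluded by `Re h > -1/2`.
  ne_zero := by
    intro h0
    have := H.re_half
    rw [eq_neg_of_add_eq_zero_left h0] at this
    norm_num at this
  twoSubAdd := H.twoSubAdd.of_eq_add 2 (by push_cast; ring)
  addAdd := H.addAdd.of_eq_add 1 (by push_cast; ring)
  twoSub_left := H.twoSub_left.of_eq_add 2 (by push_cast; ring)
  add_left := H.add_left.of_eq_add 1 (by push_cast; ring)
  twoSub_right := H.twoSub_right.of_eq_add 2 (by push_cast; ring)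
  add_right := H.add_right.of_eq_add 1 (by push_cast; ring)

theorem add_natCast (H : Admissible h x y) (n : ℕ) : Admissible (h + n) x y := by
  induction n with
  | zero => simpa using H
  | succ n ih => simpa [add_assoc] using ih.add_one

theorem twoSubAdd_companion (H : Admissible h x y) : NotNonposInt (2 * h - x + y + 2) :=
  H.twoSubAdd.add_natCast 2

theorem addAdd_companion (H : Admissible h x y) : NotNonposInt (h + x + y + 1) :=
  H.addAdd.of_eq_add 1 (by push_cast; ring)

theorem twoSub_left_companion (H : Admissible h x y) : NotNonposInt (2 * h - x + 2) :=
  H.twoSub_left.add_natCast 2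

theorem add_left_companion (H : Admissible h x y) : NotNonposInt (h + x + 1) :=
  H.add_left.of_eq_add 1 (by push_cast; ring)

theorem twoSub_right_companion (H : Admissible h x y) : NotNonposInt (2 * h - y + 1) :=
  H.twoSub_right.of_eq_add 1 (by push_cast; ring)

theorem add_right_companion (H : Admissible h x y) : NotNonposInt (h + y + 1) :=
  H.add_right.of_eq_add 1 (by push_cast; ring)

theorem summable_threeTerm (H : Admissible h x y) : Summable (threeTerm h x y) := by
  refine summable_hypergeometricTerm rfl ?_ ?_
  · simpa using ⟨H.twoSubAdd, H.addAdd⟩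
  -- The parametric excess is `2h - 2y`.
  · have := H.re_sub
    simp at this ⊢
    linarith

theorem summable_threeTermCompanion (H : Admissible h x y) :
    Summable (threeTermCompanion h x y) := by
  refine summable_hypergeometricTerm rfl ?_ ?_
  · simpa using ⟨H.twoSubAdd_companion, H.addAdd_companion⟩
  · have := H.re_sub
    simp at this ⊢
    linarith

theorem summable_fiveTerm (H : Admissible h x y) : Summable (fiveTerm h x y) := by
  refine summable_hypergeometricTerm rfl ?_ ?_
  · simpa using ⟨H.twoSub_left, H.add_left, H.twoSub_right, H.add_right⟩
  -- The parametric excess is `2h + 1`.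
  · have := H.re_half
    simp at this ⊢
    linarith

theorem summable_fiveTermCompanion (H : Admissible h x y) :
    Summable (fiveTermCompanion h x y) := by
  refine summable_hypergeometricTerm rfl ?_ ?_
  · simpa using ⟨H.twoSub_left_companion, H.add_left_companion, H.twoSub_right_companion,
      H.add_right_companion⟩
  · have := H.re_half
    simp at this ⊢
    linarith

end Admissible

/-! ### Contiguous relations -/

namespace Admissible

variable {h x y : ℂ}

/-- First row of the ₃F₂ system. All terms are rational multiples of one base term `T`, so a
certificate `V = (polynomial) * T` reduces the relation to polynomial algebra. -/
theorem threeTerm_relation (H : Admissible h x y) :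
    (h - y) * ((2 * h - x + y) * (2 * h - x + y + 1) * (h + x + y)) *
        ∑' k, threeTerm h x y k =
      h * (2 * h - x) * (h + x - y) * (2 * h - x - y + 1) *
        ∑' k, threeTerm (h + 1) x y k +
      h * y * (10 * h ^ 2 - 6 * h * (x + y) + 4 * x * y + 3 * h - x - y) *
        ∑' k, threeTermCompanion h x y k := by
  have n1 := H.twoSubAdd.of_eq_add (b := 2 * h - x + y + 2) 2 (by push_cast; ring)
  have n2 := H.addAdd.of_eq_add (b := h + x + y + 1) 1 (by push_cast; ring)
  -- Coefficients of the certificate in powers of `j + 1`, kept opaque until the polynomial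
  -- identities are checked.
  obtain ⟨q0, hq0⟩ : ∃ q : ℂ, q = y ^ 2 - 2 * x * y + x ^ 2 + 4 * h * y - 2 * h * x - h ^ 2 := ⟨_, rfl⟩
  obtain ⟨q1, hq1⟩ : ∃ q : ℂ, q = y - x + h := ⟨_, rfl⟩
  -- The base series is chosen so that each of the three series differs from it by small integer
  -- shifts. Its excess `2h - 2y` allows a certificate of degree `1`.
  obtain ⟨T, hT⟩ : ∃ T, T = hypergeometricTerm [2 * y + 1, h - x + y + 1, x + y + 1]
      [2 * h - x + y + 2, h + x + y + 1] 1 := ⟨_, rfl⟩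
  have hlim (i : ℕ) (hi : i ≤ 1) :
      Tendsto (fun n : ℕ => T n * ((n : ℂ) + 1) ^ i) atTop (𝓝 0) := by
    rw [hT]
    refine tendsto_hypergeometricTerm_mul_pow rfl (by simpa using ⟨n1, n2⟩) i ?_
    have h1 := H.re_sub
    have h2 : (i : ℝ) ≤ 1 := by exact_mod_cast hi
    simp at h1 ⊢
    linarith
  refine tsum_eq_of_telescoping (V := fun j => y * (x + y) *
      (q0 * (T j * ((j : ℂ) + 1) ^ 0) + q1 * (T j * ((j : ℂ) + 1) ^ 1)))
    H.summable_threeTerm H.add_one.summable_threeTerm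
    H.summable_threeTermCompanion ?_ ?_ ?_
  · simpa using (((hlim 0 (by norm_num)).const_mul q0).add
      ((hlim 1 (by norm_num)).const_mul q1)).const_mul (y * (x + y))
  · simp only [threeTerm, threeTermCompanion, hypergeometricTerm_zero, hT, hq0, hq1]
    push_cast
    ring
  · intro j
    have l1 := n1.add_ne_zero j
    have l2 := n2.add_ne_zero j
    have aj : (j : ℂ) + 1 ≠ 0 := by exact_mod_cast j.succ_ne_zero
    have e0 := hypergeometricTerm_three_two_succ H.twoSubAdd H.addAdd n1 n2
      (poch_succ_eq_left (a := 2 * y) (b := 2 * y + 1) j (by ring))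
      (poch_succ_eq_left (a := h - x + y) (b := h - x + y + 1) j (by ring))
      (poch_succ_eq_left (a := x + y) (b := x + y + 1) j (by ring))
      (poch_succ_eq_add_two (a := 2 * h - x + y) (b := 2 * h - x + y + 2) j (by ring))
      (poch_succ_eq_left (a := h + x + y) (b := h + x + y + 1) j (by ring))
    rw [← threeTerm, ← hT] at e0
    have e1 := hypergeometricTerm_three_two_succ H.add_one.twoSubAdd H.add_one.addAdd n1 n2
      (poch_succ_eq_left (a := 2 * y) (b := 2 * y + 1) j (by ring))
      (poch_succ_eq_right (b := h + 1 - x + y) (a := h - x + y + 1) j (by ring))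
      (poch_succ_eq_left (a := x + y) (b := x + y + 1) j (by ring))
      (poch_succ_eq_right (b := 2 * (h + 1) - x + y) (a := 2 * h - x + y + 2) j (by ring))
      (poch_succ_eq_right (b := h + 1 + x + y) (a := h + x + y + 1) j (by ring))
    rw [← threeTerm, ← hT] at e1
    have e2 := hypergeometricTerm_three_two_succ H.twoSubAdd_companion H.addAdd_companion n1 n2
      (poch_succ_eq_right (b := 2 * y + 1) (a := 2 * y + 1) j (by ring))
      (poch_succ_eq_right (b := h - x + y + 1) (a := h - x + y + 1) j (by ring))
      (poch_succ_eq_left (a := x + y) (b := x + y + 1) j (by ring))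
      (poch_succ_eq_right (b := 2 * h - x + y + 2) (a := 2 * h - x + y + 2) j (by ring))
      (poch_succ_eq_right (b := h + x + y + 1) (a := h + x + y + 1) j (by ring))
    rw [← threeTermCompanion, ← hT] at e2
    have e3 := hypergeometricTerm_three_two_succ n1 n2 n1 n2
      (poch_succ_eq_right (b := 2 * y + 1) (a := 2 * y + 1) j (by ring))
      (poch_succ_eq_right (b := h - x + y + 1) (a := h - x + y + 1) j (by ring))
      (poch_succ_eq_right (b := x + y + 1) (a := x + y + 1) j (by ring))
      (poch_succ_eq_right (b := 2 * h - x + y + 2) (a := 2 * h - x + y + 2) j (by ring))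
      (poch_succ_eq_right (b := h + x + y + 1) (a := h + x + y + 1) j (by ring))
    rw [← hT] at e3
    simp only [one_mul, mul_one] at e0 e1 e2 e3
    have step := telescoping_step (D := (2 * h - x + y + 2 + j) * (h + x + y + 1 + j)) (c := y * (x + y))
      (q := q0 + q1 * ((j : ℂ) + 1)) (q' := q0 + q1 * ((j : ℂ) + 2))
      (n₀ := h - y)
      (n₁ := h * (2 * h - x) * (h + x - y) * (2 * h - x - y + 1))
      (n₂ := h * y * (10 * h ^ 2 - 6 * h * (x + y) + 4 * x * y + 3 * h - x - y))
      (s₀ := (2 * h - x + y + 2 + j) * (h + x + y + 1 + j))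
      (s₁ := 1)
      (s₂ := 1)
      (g₁ := 1)
      (g₂ := 1)
      (p := (h - y) * ((2 * h - x + y) * (2 * h - x + y + 1) * (h + x + y))) (a := h * (2 * h - x) * (h + x - y) * (2 * h - x - y + 1)) (b := h * y * (10 * h ^ 2 - 6 * h * (x + y) + 4 * x * y + 3 * h - x - y))
      (mul_ne_zero l1 l2) aj e0 e1 e2 e3
      (mul_comm _ _) (by ring) (by ring)
      (by ring) (by ring) (by ring) 
      -- `X` is the part common to the numerators `R₁`, `R₂`, `R₃`, and `w` the resulting polynomial
      -- quotient.
      (telescoping_key_right (X := h - x + y + 1 + j) (w := 2 * (h - y) * (2 * h - x + y) - (h - x + y) * (j + 1))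
        (M₀ := 2 * (h - x + y) * (2 * h - x + y + 1 + j))
        (y₁ := 2) (u := x + y)
        (v := h * (10 * h ^ 2 - 6 * h * (x + y) + 4 * x * y + 3 * h - x - y))
        (y₂ := 2 * y + 1 + j) (z := (2 * y + 1 + j) * (x + y + 1 + j))
        (by ring) (by ring) (by ring) (by ring) (by ring)
        (by simp only [hq0, hq1]; ring) (by simp only [hq0, hq1]; ring))
    push_cast
    linear_combination step

/-- Second row of the ₃F₂ system, closing it on the pair formed by the series and its companion. -/
theorem threeTermCompanion_relation (H : Admissible h x y) :
    (2 * h - 2 * y + 1) * (2 * h - x + 2) *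
      ((2 * h - x + y + 2) * (2 * h - x + y + 3) * (h + x + y + 1)) *
        ∑' k, threeTermCompanion h x y k =
      (5 * h ^ 2 + 8 * h + 3 - 3 * h * x - 3 * h * y - 2 * x - 3 * y + 2 * x * y) *
      ((2 * h - x + y + 2) * (2 * h - x + y + 3) * (h + x + y + 1)) *
        ∑' k, threeTerm (h + 1) x y k +
      -((h + 1) * (2 * h - 2 * x + 3) * (h - x + 1) * (2 * h - x - y + 2) * (h - x + y + 1)) *
        ∑' k, threeTermCompanion (h + 1) x y k := by
  have n1 := H.twoSubAdd.of_eq_add (b := 2 * h - x + y + 4) 4 (by push_cast; ring)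
  have n2 := H.addAdd.of_eq_add (b := h + x + y + 2) 2 (by push_cast; ring)
  obtain ⟨q0, hq0⟩ : ∃ q : ℂ, q = 6 + 3 * y + y ^ 2 - 7 * x - x * y + 2 * x ^ 2 + 22 * h + 8 * h * y + h * y ^ 2
        - 18 * h * x - 2 * h * x * y + 3 * h * x ^ 2 + 26 * h ^ 2 + 5 * h ^ 2 * y - 11 * h ^ 2 * x
        + 10 * h ^ 3 := ⟨_, rfl⟩
  obtain ⟨q1, hq1⟩ : ∃ q : ℂ, q = 6 + 3 * y - 5 * x - x * y + x ^ 2 + 14 * h + 3 * h * y - 6 * h * x + 8 * h ^ 2 := ⟨_, rfl⟩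
  obtain ⟨q2, hq2⟩ : ∃ q : ℂ, q = 2 - x + 2 * h := ⟨_, rfl⟩
  -- Excess `2h - 2y + 2`, enough for the quadratic certificate.
  obtain ⟨T, hT⟩ : ∃ T, T = hypergeometricTerm [2 * y + 1, h - x + y + 2, x + y + 1]
      [2 * h - x + y + 4, h + x + y + 2] 1 := ⟨_, rfl⟩
  have hlim (i : ℕ) (hi : i ≤ 2) :
      Tendsto (fun n : ℕ => T n * ((n : ℂ) + 1) ^ i) atTop (𝓝 0) := by
    rw [hT]
    refine tendsto_hypergeometricTerm_mul_pow rfl (by simpa using ⟨n1, n2⟩) i ?_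
    have h1 := H.re_sub
    have h2 : (i : ℝ) ≤ 2 := by exact_mod_cast hi
    simp at h1 ⊢
    linarith
  refine tsum_eq_of_telescoping (V := fun j => (h - x + y + 1) * (x + y) *
      (q0 * (T j * ((j : ℂ) + 1) ^ 0) + q1 * (T j * ((j : ℂ) + 1) ^ 1) + q2 * (T j * ((j : ℂ) + 1) ^ 2)))
    H.summable_threeTermCompanion H.add_one.summable_threeTerm
    H.add_one.summable_threeTermCompanion ?_ ?_ ?_
  · simpa using ((((hlim 0 (by norm_num)).const_mul q0).add
      ((hlim 1 (by norm_num)).const_mul q1)).add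
      ((hlim 2 (by norm_num)).const_mul q2)).const_mul ((h - x + y + 1) * (x + y))
  · simp only [threeTerm, threeTermCompanion, hypergeometricTerm_zero, hT, hq0, hq1, hq2]
    push_cast
    ring
  · intro j
    have l1 := n1.add_ne_zero j
    have l2 := n2.add_ne_zero j
    have aj : (j : ℂ) + 1 ≠ 0 := by exact_mod_cast j.succ_ne_zero
    have e0 := hypergeometricTerm_three_two_succ H.twoSubAdd_companion H.addAdd_companion n1 n2
      (poch_succ_eq_right (b := 2 * y + 1) (a := 2 * y + 1) j (by ring))
      (poch_succ_eq_left (a := h - x + y + 1) (b := h - x + y + 2) j (by ring))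
      (poch_succ_eq_left (a := x + y) (b := x + y + 1) j (by ring))
      (poch_succ_eq_add_two (a := 2 * h - x + y + 2) (b := 2 * h - x + y + 4) j (by ring))
      (poch_succ_eq_left (a := h + x + y + 1) (b := h + x + y + 2) j (by ring))
    rw [← threeTermCompanion, ← hT] at e0
    have e1 := hypergeometricTerm_three_two_succ H.add_one.twoSubAdd H.add_one.addAdd n1 n2
      (poch_succ_eq_left (a := 2 * y) (b := 2 * y + 1) j (by ring))
      (poch_succ_eq_left (a := h + 1 - x + y) (b := h - x + y + 2) j (by ring))
      (poch_succ_eq_left (a := x + y) (b := x + y + 1) j (by ring))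
      (poch_succ_eq_add_two (a := 2 * (h + 1) - x + y) (b := 2 * h - x + y + 4) j (by ring))
      (poch_succ_eq_left (a := h + 1 + x + y) (b := h + x + y + 2) j (by ring))
    rw [← threeTerm, ← hT] at e1
    have e2 := hypergeometricTerm_three_two_succ H.add_one.twoSubAdd_companion H.add_one.addAdd_companion n1 n2
      (poch_succ_eq_right (b := 2 * y + 1) (a := 2 * y + 1) j (by ring))
      (poch_succ_eq_right (b := h + 1 - x + y + 1) (a := h - x + y + 2) j (by ring))
      (poch_succ_eq_left (a := x + y) (b := x + y + 1) j (by ring))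
      (poch_succ_eq_right (b := 2 * (h + 1) - x + y + 2) (a := 2 * h - x + y + 4) j (by ring))
      (poch_succ_eq_right (b := h + 1 + x + y + 1) (a := h + x + y + 2) j (by ring))
    rw [← threeTermCompanion, ← hT] at e2
    have e3 := hypergeometricTerm_three_two_succ n1 n2 n1 n2
      (poch_succ_eq_right (b := 2 * y + 1) (a := 2 * y + 1) j (by ring))
      (poch_succ_eq_right (b := h - x + y + 2) (a := h - x + y + 2) j (by ring))
      (poch_succ_eq_right (b := x + y + 1) (a := x + y + 1) j (by ring))
      (poch_succ_eq_right (b := 2 * h - x + y + 4) (a := 2 * h - x + y + 4) j (by ring))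
      (poch_succ_eq_right (b := h + x + y + 2) (a := h + x + y + 2) j (by ring))
    rw [← hT] at e3
    simp only [one_mul, mul_one] at e0 e1 e2 e3
    have step := telescoping_step (D := (2 * h - x + y + 4 + j) * (h + x + y + 2 + j)) (c := (h - x + y + 1) * (x + y))
      (q := q0 + q1 * ((j : ℂ) + 1) + q2 * ((j : ℂ) + 1) ^ 2) (q' := q0 + q1 * ((j : ℂ) + 2) + q2 * ((j : ℂ) + 2) ^ 2)
      (n₀ := (2 * h - 2 * y + 1) * (2 * h - x + 2))
      (n₁ := (5 * h ^ 2 + 8 * h + 3 - 3 * h * x - 3 * h * y - 2 * x - 3 * y + 2 * x * y))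
      (n₂ := -((h + 1) * (2 * h - 2 * x + 3) * (h - x + 1) * (2 * h - x - y + 2) * (h - x + y + 1)))
      (s₀ := (2 * h - x + y + 4 + j) * (h + x + y + 2 + j))
      (s₁ := (2 * h - x + y + 4 + j) * (h + x + y + 2 + j))
      (s₂ := 1)
      (g₂ := 1)
      (p := (2 * h - 2 * y + 1) * (2 * h - x + 2) *
      ((2 * h - x + y + 2) * (2 * h - x + y + 3) * (h + x + y + 1))) (a := (5 * h ^ 2 + 8 * h + 3 - 3 * h * x - 3 * h * y - 2 * x - 3 * y + 2 * x * y) *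
      ((2 * h - x + y + 2) * (2 * h - x + y + 3) * (h + x + y + 1))) (b := -((h + 1) * (2 * h - 2 * x + 3) * (h - x + 1) * (2 * h - x - y + 2) * (h - x + y + 1)))
      (mul_ne_zero l1 l2) aj e0 e1 e2 e3
      (mul_comm _ _) (mul_comm _ _) (by ring)
      (by ring) (by ring) (by ring) 
      (telescoping_key_left (X := (2 * y + 1 + j) * (h - x + y + 2 + j)) (w := -(2 * h - x + 2) * (j + 1) - (h + 1) * (2 * h - x + y + 2))
        (M₀ := (2 * y + 1 + j) * (2 * h - x + y + 3 + j))
        (M₁ := 2 * y * (2 * h - x + y + 3 + j)) (u := x + y)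
        (v := -((h + 1) * (2 * h - 2 * x + 3) * (h - x + 1) * (2 * h - x - y + 2)))
        (y₂ := 1) (z := x + y + 1 + j)
        (by ring) (by ring) (by ring) (by ring) (by ring)
        (by simp only [hq0, hq1, hq2]; ring) (by simp only [hq0, hq1, hq2]; ring))
    push_cast
    linear_combination step

end Admissible

/-! ### Contiguous relations for the well-poised series -/

namespace Admissible

variable {h x y : ℂ}

/-- The factor `10h² - 6h(x + y) + 4xy + 3h - x - y` is the one in `threeTerm_relation`; the
remaining factors differ by what the Gamma quotients absorb. -/
theorem fiveTerm_relation (H : Admissible h x y) :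
    ((2 * h - x) * (2 * h - x + 1) * (2 * h - y) * (2 * h - y + 1) * (h + x) * (h + y)) *
        ∑' k, fiveTerm h x y k =
      2 * h ^ 2 * ((2 * h - x) * (2 * h - 2 * y + 1) * (h + x - y) * (2 * h - x - y + 1)) *
        ∑' k, fiveTerm (h + 1) x y k +
      2 * h ^ 2 * y * (2 * h - y + 1) *
        (10 * h ^ 2 - 6 * h * (x + y) + 4 * x * y + 3 * h - x - y) *
        ∑' k, fiveTermCompanion h x y k := by
  have n1 := H.twoSub_left.of_eq_add (b := 2 * h - x + 2) 2 (by push_cast; ring)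
  have n2 := H.add_left.of_eq_add (b := h + x + 1) 1 (by push_cast; ring)
  have n3 := H.twoSub_right.of_eq_add (b := 2 * h - y + 2) 2 (by push_cast; ring)
  have n4 := H.add_right.of_eq_add (b := h + y + 1) 1 (by push_cast; ring)
  obtain ⟨q0, hq0⟩ : ∃ q : ℂ, q = -x ^ 2 * y ^ 2 + h * y ^ 2 + 3 * h * x * y ^ 2 + h * x ^ 2 + 3 * h * x ^ 2 * y
        - 3 * h ^ 2 * y - 4 * h ^ 2 * y ^ 2 - 3 * h ^ 2 * x - 9 * h ^ 2 * x * y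
        - 4 * h ^ 2 * x ^ 2 + 4 * h ^ 3 + 12 * h ^ 3 * y + 12 * h ^ 3 * x - 12 * h ^ 4 := ⟨_, rfl⟩
  obtain ⟨q1, hq1⟩ : ∃ q : ℂ, q = x * y ^ 2 + x ^ 2 * y - h * y - 2 * h * y ^ 2 - h * x - 6 * h * x * y - 2 * h * x ^ 2
        + 3 * h ^ 2 + 10 * h ^ 2 * y + 10 * h ^ 2 * x - 14 * h ^ 3 := ⟨_, rfl⟩
  obtain ⟨q2, hq2⟩ : ∃ q : ℂ, q = -x * y + 2 * h * y + 2 * h * x - 4 * h ^ 2 := ⟨_, rfl⟩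
  -- Excess `2h + 2`, so `Re (2h + 1) > 0` suffices for the quadratic certificate.
  obtain ⟨T, hT⟩ : ∃ T, T = hypergeometricTerm [2 * h, x + 1, h - x + 1, y + 1, h - y + 1]
      [2 * h - x + 2, h + x + 1, 2 * h - y + 2, h + y + 1] 1 := ⟨_, rfl⟩
  have hlim (i : ℕ) (hi : i ≤ 2) :
      Tendsto (fun n : ℕ => T n * ((n : ℂ) + 1) ^ i) atTop (𝓝 0) := by
    rw [hT]
    refine tendsto_hypergeometricTerm_mul_pow rfl (by simpa using ⟨n1, n2, n3, n4⟩) i ?_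
    have h1 := H.re_half
    have h2 : (i : ℝ) ≤ 2 := by exact_mod_cast hi
    simp at h1 ⊢
    linarith
  refine tsum_eq_of_telescoping (V := fun j => x * y *
      (q0 * (T j * ((j : ℂ) + 1) ^ 0) + q1 * (T j * ((j : ℂ) + 1) ^ 1) + q2 * (T j * ((j : ℂ) + 1) ^ 2)))
    H.summable_fiveTerm H.add_one.summable_fiveTerm
    H.summable_fiveTermCompanion ?_ ?_ ?_
  · simpa using ((((hlim 0 (by norm_num)).const_mul q0).add
      ((hlim 1 (by norm_num)).const_mul q1)).add
      ((hlim 2 (by norm_num)).const_mul q2)).const_mul (x * y)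
  · simp only [fiveTerm, fiveTermCompanion, hypergeometricTerm_zero, hT, hq0, hq1, hq2]
    push_cast
    ring
  · intro j
    have l1 := n1.add_ne_zero j
    have l2 := n2.add_ne_zero j
    have l3 := n3.add_ne_zero j
    have l4 := n4.add_ne_zero j
    have aj : (j : ℂ) + 1 ≠ 0 := by exact_mod_cast j.succ_ne_zero
    have e0 := hypergeometricTerm_five_four_succ H.twoSub_left H.add_left H.twoSub_right H.add_right n1 n2 n3 n4
      (poch_succ_eq_left (a := 2 * h - 1) (b := 2 * h) j (by ring))
      (poch_succ_eq_left (a := x) (b := x + 1) j (by ring))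
      (poch_succ_eq_left (a := h - x) (b := h - x + 1) j (by ring))
      (poch_succ_eq_left (a := y) (b := y + 1) j (by ring))
      (poch_succ_eq_left (a := h - y) (b := h - y + 1) j (by ring))
      (poch_succ_eq_add_two (a := 2 * h - x) (b := 2 * h - x + 2) j (by ring))
      (poch_succ_eq_left (a := h + x) (b := h + x + 1) j (by ring))
      (poch_succ_eq_add_two (a := 2 * h - y) (b := 2 * h - y + 2) j (by ring))
      (poch_succ_eq_left (a := h + y) (b := h + y + 1) j (by ring))
    rw [← fiveTerm, ← hT] at e0
    have e1 := hypergeometricTerm_five_four_succ H.add_one.twoSub_left H.add_one.add_left H.add_one.twoSub_right H.add_one.add_right n1 n2 n3 n4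
      (poch_succ_eq_add_one (a := 2 * h) (b := 2 * (h + 1) - 1) j (by ring))
      (poch_succ_eq_left (a := x) (b := x + 1) j (by ring))
      (poch_succ_eq_right (b := h + 1 - x) (a := h - x + 1) j (by ring))
      (poch_succ_eq_left (a := y) (b := y + 1) j (by ring))
      (poch_succ_eq_right (b := h + 1 - y) (a := h - y + 1) j (by ring))
      (poch_succ_eq_right (b := 2 * (h + 1) - x) (a := 2 * h - x + 2) j (by ring))
      (poch_succ_eq_right (b := h + 1 + x) (a := h + x + 1) j (by ring))
      (poch_succ_eq_right (b := 2 * (h + 1) - y) (a := 2 * h - y + 2) j (by ring))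
      (poch_succ_eq_right (b := h + 1 + y) (a := h + y + 1) j (by ring))
    rw [← fiveTerm, ← hT] at e1
    have e2 := hypergeometricTerm_five_four_succ H.twoSub_left_companion H.add_left_companion H.twoSub_right_companion H.add_right_companion n1 n2 n3 n4
      (poch_succ_eq_add_one (a := 2 * h) (b := 2 * h + 1) j (by ring))
      (poch_succ_eq_left (a := x) (b := x + 1) j (by ring))
      (poch_succ_eq_right (b := h - x + 1) (a := h - x + 1) j (by ring))
      (poch_succ_eq_right (b := y + 1) (a := y + 1) j (by ring))
      (poch_succ_eq_right (b := h - y + 1) (a := h - y + 1) j (by ring))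
      (poch_succ_eq_right (b := 2 * h - x + 2) (a := 2 * h - x + 2) j (by ring))
      (poch_succ_eq_right (b := h + x + 1) (a := h + x + 1) j (by ring))
      (poch_succ_eq_left (a := 2 * h - y + 1) (b := 2 * h - y + 2) j (by ring))
      (poch_succ_eq_right (b := h + y + 1) (a := h + y + 1) j (by ring))
    rw [← fiveTermCompanion, ← hT] at e2
    have e3 := hypergeometricTerm_five_four_succ n1 n2 n3 n4 n1 n2 n3 n4
      (poch_succ_eq_right (b := 2 * h) (a := 2 * h) j (by ring))
      (poch_succ_eq_right (b := x + 1) (a := x + 1) j (by ring))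
      (poch_succ_eq_right (b := h - x + 1) (a := h - x + 1) j (by ring))
      (poch_succ_eq_right (b := y + 1) (a := y + 1) j (by ring))
      (poch_succ_eq_right (b := h - y + 1) (a := h - y + 1) j (by ring))
      (poch_succ_eq_right (b := 2 * h - x + 2) (a := 2 * h - x + 2) j (by ring))
      (poch_succ_eq_right (b := h + x + 1) (a := h + x + 1) j (by ring))
      (poch_succ_eq_right (b := 2 * h - y + 2) (a := 2 * h - y + 2) j (by ring))
      (poch_succ_eq_right (b := h + y + 1) (a := h + y + 1) j (by ring))
    rw [← hT] at e3
    simp only [one_mul, mul_one] at e0 e1 e2 e3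
    have step := telescoping_step (D := (2 * h - x + 2 + j) * (h + x + 1 + j) * (2 * h - y + 2 + j) * (h + y + 1 + j)) (c := x * y)
      (q := q0 + q1 * ((j : ℂ) + 1) + q2 * ((j : ℂ) + 1) ^ 2) (q' := q0 + q1 * ((j : ℂ) + 2) + q2 * ((j : ℂ) + 2) ^ 2)
      (n₀ := 1)
      (n₁ := h * ((2 * h - x) * (2 * h - 2 * y + 1) * (h + x - y) * (2 * h - x - y + 1)))
      (n₂ := h * y * (10 * h ^ 2 - 6 * h * (x + y) + 4 * x * y + 3 * h - x - y))
      (s₀ := (2 * h - x + 2 + j) * (h + x + 1 + j) * (2 * h - y + 2 + j) * (h + y + 1 + j))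
      (s₁ := 1)
      (s₂ := 2 * h - y + 2 + j)
      (g₁ := 2 * h)
      (g₂ := 2 * h * (2 * h - y + 1))
      (p := ((2 * h - x) * (2 * h - x + 1) * (2 * h - y) * (2 * h - y + 1) * (h + x) * (h + y))) (a := 2 * h ^ 2 * ((2 * h - x) * (2 * h - 2 * y + 1) * (h + x - y) * (2 * h - x - y + 1))) (b := 2 * h ^ 2 * y * (2 * h - y + 1) *
        (10 * h ^ 2 - 6 * h * (x + y) + 4 * x * y + 3 * h - x - y))
      (mul_ne_zero (mul_ne_zero (mul_ne_zero l1 l2) l3) l4) aj e0 e1 e2 e3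
      (mul_comm _ _) (by ring) (by ring)
      (by ring) (by ring) (by ring) 
      (telescoping_key_right (X := (2 * h + j) * (h - x + 1 + j) * (h - y + 1 + j)) (w := (2 * h - x) * (2 * h - y))
        (M₀ := (2 * h - 1) * (h - x) * (h - y) * (2 * h - x + 1 + j) * (2 * h - y + 1 + j))
        (y₁ := 2 * h + j + 1) (u := x)
        (v := h * (10 * h ^ 2 - 6 * h * (x + y) + 4 * x * y + 3 * h - x - y))
        (y₂ := (2 * h + j + 1) * (y + 1 + j)) (z := (x + 1 + j) * (y + 1 + j))
        (by ring) (by ring) (by ring) (by ring) (by ring)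
        (by simp only [hq0, hq1, hq2]; ring) (by simp only [hq0, hq1, hq2]; ring))
    push_cast
    linear_combination step

end Admissible

namespace Admissible

variable {h x y : ℂ}

/-- Again the irreducible-looking quadratic factor in `h` is that of `threeTermCompanion_relation`,
which makes a rescaling by Gamma quotients possible. -/
theorem fiveTermCompanion_relation (H : Admissible h x y) :
    (2 * h - x + 2) *
      ((2 * h - x + 2) * (2 * h - x + 3) * (h + x + 1) * (2 * h - y + 1) * (2 * h - y + 2) * (h + y + 1)) *
        ∑' k, fiveTermCompanion h x y k =
      (5 * h ^ 2 + 8 * h + 3 - 3 * h * x - 3 * h * y - 2 * x - 3 * y + 2 * x * y) *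
      ((2 * h - x + 2) * (2 * h - x + 3) * (h + x + 1) * (2 * h - y + 2) * (h + y + 1)) *
        ∑' k, fiveTerm (h + 1) x y k +
      -(2 * (h + 1) ^ 2 * ((2 * h - 2 * x + 3) * (h - x + y + 1) * (2 * h - x - y + 2) * (h - x + 1) * (h - y + 1))) *
        ∑' k, fiveTermCompanion (h + 1) x y k := by
  have n1 := H.twoSub_left.of_eq_add (b := 2 * h - x + 4) 4 (by push_cast; ring)
  have n2 := H.add_left.of_eq_add (b := h + x + 2) 2 (by push_cast; ring)
  have n3 := H.twoSub_right.of_eq_add (b := 2 * h - y + 3) 3 (by push_cast; ring)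
  have n4 := H.add_right.of_eq_add (b := h + y + 2) 2 (by push_cast; ring)
  obtain ⟨q0, hq0⟩ : ∃ q : ℂ, q = 6 + 3 * y - 3 * y ^ 2 - 7 * x - 3 * x * y + 3 * x * y ^ 2 + 2 * x ^ 2 + x ^ 2 * y
        - x ^ 2 * y ^ 2 + 34 * h + 10 * h * y - 7 * h * y ^ 2 - 32 * h * x - 6 * h * x * y
        + 3 * h * x * y ^ 2 + 7 * h * x ^ 2 + h * x ^ 2 * y + 70 * h ^ 2 + 11 * h ^ 2 * y
        - 4 * h ^ 2 * y ^ 2 - 47 * h ^ 2 * x - 3 * h ^ 2 * x * y + 6 * h ^ 2 * x ^ 2 + 62 * h ^ 3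
        + 4 * h ^ 3 * y - 22 * h ^ 3 * x + 20 * h ^ 4 := ⟨_, rfl⟩
  obtain ⟨q1, hq1⟩ : ∃ q : ℂ, q = 12 + 2 * y - 2 * y ^ 2 - 12 * x - x * y + x * y ^ 2 + 3 * x ^ 2 + 48 * h + 4 * h * y
        - 2 * h * y ^ 2 - 34 * h * x - h * x * y + 5 * h * x ^ 2 + 62 * h ^ 2 + 2 * h ^ 2 * y
        - 23 * h ^ 2 * x + 26 * h ^ 3 := ⟨_, rfl⟩
  obtain ⟨q2, hq2⟩ : ∃ q : ℂ, q = 8 - 6 * x + x ^ 2 + 20 * h - 8 * h * x + 12 * h ^ 2 := ⟨_, rfl⟩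
  obtain ⟨q3, hq3⟩ : ∃ q : ℂ, q = 2 - x + 2 * h := ⟨_, rfl⟩
  -- Excess `2h + 3`, enough for the cubic certificate.
  obtain ⟨T, hT⟩ : ∃ T, T = hypergeometricTerm [2 * h + 2, x + 1, h - x + 2, y + 1, h - y + 2]
      [2 * h - x + 4, h + x + 2, 2 * h - y + 3, h + y + 2] 1 := ⟨_, rfl⟩
  have hlim (i : ℕ) (hi : i ≤ 3) :
      Tendsto (fun n : ℕ => T n * ((n : ℂ) + 1) ^ i) atTop (𝓝 0) := by
    rw [hT]
    refine tendsto_hypergeometricTerm_mul_pow rfl (by simpa using ⟨n1, n2, n3, n4⟩) i ?_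
    have h1 := H.re_half
    have h2 : (i : ℝ) ≤ 3 := by exact_mod_cast hi
    simp at h1 ⊢
    linarith
  refine tsum_eq_of_telescoping (V := fun j => x * (h - x + 1) * (h - y + 1) *
      (q0 * (T j * ((j : ℂ) + 1) ^ 0) + q1 * (T j * ((j : ℂ) + 1) ^ 1) + q2 * (T j * ((j : ℂ) + 1) ^ 2) + q3 * (T j * ((j : ℂ) + 1) ^ 3)))
    H.summable_fiveTermCompanion H.add_one.summable_fiveTerm
    H.add_one.summable_fiveTermCompanion ?_ ?_ ?_
  · simpa using (((((hlim 0 (by norm_num)).const_mul q0).add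
      ((hlim 1 (by norm_num)).const_mul q1)).add
      ((hlim 2 (by norm_num)).const_mul q2)).add
      ((hlim 3 (by norm_num)).const_mul q3)).const_mul (x * (h - x + 1) * (h - y + 1))
  · simp only [fiveTerm, fiveTermCompanion, hypergeometricTerm_zero, hT, hq0, hq1, hq2, hq3]
    push_cast
    ring
  · intro j
    have l1 := n1.add_ne_zero j
    have l2 := n2.add_ne_zero j
    have l3 := n3.add_ne_zero j
    have l4 := n4.add_ne_zero j
    have aj : (j : ℂ) + 1 ≠ 0 := by exact_mod_cast j.succ_ne_zero
    have e0 := hypergeometricTerm_five_four_succ H.twoSub_left_companion H.add_left_companion H.twoSub_right_companion H.add_right_companion n1 n2 n3 n4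
      (poch_succ_eq_left (a := 2 * h + 1) (b := 2 * h + 2) j (by ring))
      (poch_succ_eq_left (a := x) (b := x + 1) j (by ring))
      (poch_succ_eq_left (a := h - x + 1) (b := h - x + 2) j (by ring))
      (poch_succ_eq_right (b := y + 1) (a := y + 1) j (by ring))
      (poch_succ_eq_left (a := h - y + 1) (b := h - y + 2) j (by ring))
      (poch_succ_eq_add_two (a := 2 * h - x + 2) (b := 2 * h - x + 4) j (by ring))
      (poch_succ_eq_left (a := h + x + 1) (b := h + x + 2) j (by ring))
      (poch_succ_eq_add_two (a := 2 * h - y + 1) (b := 2 * h - y + 3) j (by ring))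
      (poch_succ_eq_left (a := h + y + 1) (b := h + y + 2) j (by ring))
    rw [← fiveTermCompanion, ← hT] at e0
    have e1 := hypergeometricTerm_five_four_succ H.add_one.twoSub_left H.add_one.add_left H.add_one.twoSub_right H.add_one.add_right n1 n2 n3 n4
      (poch_succ_eq_left (a := 2 * (h + 1) - 1) (b := 2 * h + 2) j (by ring))
      (poch_succ_eq_left (a := x) (b := x + 1) j (by ring))
      (poch_succ_eq_left (a := h + 1 - x) (b := h - x + 2) j (by ring))
      (poch_succ_eq_left (a := y) (b := y + 1) j (by ring))
      (poch_succ_eq_left (a := h + 1 - y) (b := h - y + 2) j (by ring))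
      (poch_succ_eq_add_two (a := 2 * (h + 1) - x) (b := 2 * h - x + 4) j (by ring))
      (poch_succ_eq_left (a := h + 1 + x) (b := h + x + 2) j (by ring))
      (poch_succ_eq_left (a := 2 * (h + 1) - y) (b := 2 * h - y + 3) j (by ring))
      (poch_succ_eq_left (a := h + 1 + y) (b := h + y + 2) j (by ring))
    rw [← fiveTerm, ← hT] at e1
    have e2 := hypergeometricTerm_five_four_succ H.add_one.twoSub_left_companion H.add_one.add_left_companion H.add_one.twoSub_right_companion H.add_one.add_right_companion n1 n2 n3 n4
      (poch_succ_eq_add_one (a := 2 * h + 2) (b := 2 * (h + 1) + 1) j (by ring))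
      (poch_succ_eq_left (a := x) (b := x + 1) j (by ring))
      (poch_succ_eq_right (b := h + 1 - x + 1) (a := h - x + 2) j (by ring))
      (poch_succ_eq_right (b := y + 1) (a := y + 1) j (by ring))
      (poch_succ_eq_right (b := h + 1 - y + 1) (a := h - y + 2) j (by ring))
      (poch_succ_eq_right (b := 2 * (h + 1) - x + 2) (a := 2 * h - x + 4) j (by ring))
      (poch_succ_eq_right (b := h + 1 + x + 1) (a := h + x + 2) j (by ring))
      (poch_succ_eq_right (b := 2 * (h + 1) - y + 1) (a := 2 * h - y + 3) j (by ring))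
      (poch_succ_eq_right (b := h + 1 + y + 1) (a := h + y + 2) j (by ring))
    rw [← fiveTermCompanion, ← hT] at e2
    have e3 := hypergeometricTerm_five_four_succ n1 n2 n3 n4 n1 n2 n3 n4
      (poch_succ_eq_right (b := 2 * h + 2) (a := 2 * h + 2) j (by ring))
      (poch_succ_eq_right (b := x + 1) (a := x + 1) j (by ring))
      (poch_succ_eq_right (b := h - x + 2) (a := h - x + 2) j (by ring))
      (poch_succ_eq_right (b := y + 1) (a := y + 1) j (by ring))
      (poch_succ_eq_right (b := h - y + 2) (a := h - y + 2) j (by ring))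
      (poch_succ_eq_right (b := 2 * h - x + 4) (a := 2 * h - x + 4) j (by ring))
      (poch_succ_eq_right (b := h + x + 2) (a := h + x + 2) j (by ring))
      (poch_succ_eq_right (b := 2 * h - y + 3) (a := 2 * h - y + 3) j (by ring))
      (poch_succ_eq_right (b := h + y + 2) (a := h + y + 2) j (by ring))
    rw [← hT] at e3
    simp only [one_mul, mul_one] at e0 e1 e2 e3
    have step := telescoping_step (D := (2 * h - x + 4 + j) * (h + x + 2 + j) * (2 * h - y + 3 + j) * (h + y + 2 + j)) (c := x * (h - x + 1) * (h - y + 1))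
      (q := q0 + q1 * ((j : ℂ) + 1) + q2 * ((j : ℂ) + 1) ^ 2 + q3 * ((j : ℂ) + 1) ^ 3) (q' := q0 + q1 * ((j : ℂ) + 2) + q2 * ((j : ℂ) + 2) ^ 2 + q3 * ((j : ℂ) + 2) ^ 3)
      (n₀ := 2 * h - x + 2)
      (n₁ := (5 * h ^ 2 + 8 * h + 3 - 3 * h * x - 3 * h * y - 2 * x - 3 * y + 2 * x * y))
      (n₂ := -((h + 1) * ((2 * h - 2 * x + 3) * (h - x + y + 1) * (2 * h - x - y + 2) * (h - x + 1) * (h - y + 1))))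
      (s₀ := (2 * h - x + 4 + j) * (h + x + 2 + j) * (2 * h - y + 3 + j) * (h + y + 2 + j))
      (s₁ := (2 * h - x + 4 + j) * (h + x + 2 + j) * (2 * h - y + 3 + j) * (h + y + 2 + j))
      (s₂ := 1)
      (g₂ := 2 * h + 2)
      (p := (2 * h - x + 2) *
      ((2 * h - x + 2) * (2 * h - x + 3) * (h + x + 1) * (2 * h - y + 1) * (2 * h - y + 2) * (h + y + 1))) (a := (5 * h ^ 2 + 8 * h + 3 - 3 * h * x - 3 * h * y - 2 * x - 3 * y + 2 * x * y) *
      ((2 * h - x + 2) * (2 * h - x + 3) * (h + x + 1) * (2 * h - y + 2) * (h + y + 1))) (b := -(2 * (h + 1) ^ 2 * ((2 * h - 2 * x + 3) * (h - x + y + 1) * (2 * h - x - y + 2) * (h - x + 1) * (h - y + 1))))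
      (mul_ne_zero (mul_ne_zero (mul_ne_zero l1 l2) l3) l4) aj e0 e1 e2 e3
      (mul_comm _ _) (mul_comm _ _) (by ring)
      (by ring) (by ring) (by ring) 
      (telescoping_key_left (X := (2 * h + 2 + j) * (h - x + 2 + j) * (y + 1 + j) * (h - y + 2 + j)) (w := -(2 * h - x + 2))
        (M₀ := (2 * h + 1) * (y + 1 + j) * (2 * h - x + 3 + j) * (2 * h - y + 2 + j))
        (M₁ := (2 * h + 1) * y * (2 * h - x + 3 + j)) (u := x)
        (v := -((h + 1) * (2 * h - 2 * x + 3) * (h - x + y + 1) * (2 * h - x - y + 2)))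
        (y₂ := 2 * h + 2 + j + 1) (z := x + 1 + j)
        (by ring) (by ring) (by ring) (by ring) (by ring)
        (by simp only [hq0, hq1, hq2, hq3]; ring) (by simp only [hq0, hq1, hq2, hq3]; ring))
    push_cast
    linear_combination step

end Admissible

/-! ### Limits of the series -/

theorem norm_natCast_add_one (k : ℕ) : ‖(k : ℂ) + 1‖ = k + 1 := by
  have : (k : ℂ) + 1 = ((k + 1 : ℕ) : ℂ) := by push_cast; ring
  rw [this, Complex.norm_natCast]; push_cast; ring

/-- Dominated convergence: once `S N` exceeds `2K + 1`, the terms are bounded by those of `₂F₁[K, K;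
2K + 1; 1]`, while each term of positive index tends to `0`. -/
theorem tendsto_tsum_one_of_ratio_le {t : ℕ → ℕ → ℂ} {K : ℝ} {S : ℕ → ℝ} (hK : 0 ≤ K)
    (hS : Tendsto S atTop atTop) (h0 : ∀ N, t N 0 = 1)
    (hr : ∀ N k, ‖t N (k + 1)‖ * ((S N + k) * (k + 1)) ≤ ‖t N k‖ * (K + k) ^ 2) :
    Tendsto (fun N => ∑' k, t N k) atTop (𝓝 1) := by
  -- Makes the excess of the dominating series equal to `1`.
  set s : ℝ := 2 * K + 1 with hs
  have hs0 : 0 < s := by positivity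
  have ns : NotNonposInt (s : ℂ) := notNonposInt_of_re_pos (by simpa using hs0)
  set B : ℕ → ℝ := fun k => ‖hypergeometricTerm [(K : ℂ), (K : ℂ)] [(s : ℂ)] 1 k‖ with hB
  have hBs : Summable B := (summable_hypergeometricTerm rfl (by simpa using ns)
    (by simp [hs]; linarith)).norm
  have hB0 : B 0 = 1 := by simp [hB, hypergeometricTerm_zero]
  have hBr : ∀ k, B (k + 1) * ((s + k) * (k + 1)) = B k * (K + k) ^ 2 := by
    intro k
    have e1 : ‖(s : ℂ) + k‖ = s + k := by
      have : (s : ℂ) + k = ((s + k : ℝ) : ℂ) := by push_cast; ring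
      rw [this, Complex.norm_real, Real.norm_of_nonneg (by positivity)]
    have e2 : ‖(K : ℂ) + k‖ = K + k := by
      have : (K : ℂ) + k = ((K + k : ℝ) : ℂ) := by push_cast; ring
      rw [this, Complex.norm_real, Real.norm_of_nonneg (by positivity)]
    have key : hypergeometricTerm [(K : ℂ), (K : ℂ)] [(s : ℂ)] 1 (k + 1) *
        (((s : ℂ) + k) * (k + 1)) =
        hypergeometricTerm [(K : ℂ), (K : ℂ)] [(s : ℂ)] 1 k * ((K : ℂ) + k) ^ 2 := by
      have hp := poch_ne_zero ns k
      have hk := ns.add_ne_zero k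
      have aj : (k : ℂ) + 1 ≠ 0 := by exact_mod_cast k.succ_ne_zero
      have af : (k.factorial : ℂ) ≠ 0 := by exact_mod_cast k.factorial_ne_zero
      have expand : ∀ n, hypergeometricTerm [(K : ℂ), (K : ℂ)] [(s : ℂ)] 1 n =
          poch K n * poch K n / (poch s n * n.factorial) := by
        intro n
        simp [hypergeometricTerm, poch]
      rw [expand, expand, poch_succ, poch_succ, Nat.factorial_succ]
      push_cast
      field_simp
    have := congrArg norm key
    simpa only [norm_mul, norm_pow, e1, e2, norm_natCast_add_one] using this
  have hev : ∀ᶠ N in atTop, ∀ k, ‖t N k‖ ≤ B k := by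
    filter_upwards [hS.eventually_ge_atTop s] with N hN k
    induction k with
    | zero => simp [h0, hB0]
    | succ k ih =>
      have hpos : 0 < (s + k) * ((k : ℝ) + 1) := by positivity
      refine le_of_mul_le_mul_right ?_ hpos
      rw [hBr]
      calc ‖t N (k + 1)‖ * ((s + k) * (k + 1)) ≤ ‖t N (k + 1)‖ * ((S N + k) * (k + 1)) := by gcongr
        _ ≤ ‖t N k‖ * (K + k) ^ 2 := hr N k
        _ ≤ B k * (K + k) ^ 2 := by gcongr
  have hterm : ∀ k, Tendsto (fun N => t N k) atTop (𝓝 (if k = 0 then 1 else 0)) := by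
    intro k
    cases k with
    | zero => simp [h0]
    | succ k =>
      simp only [Nat.succ_ne_zero, if_false]
      have h1 : Tendsto (fun N => B k * (K + k) ^ 2 / ((S N + k) * (k + 1))) atTop (𝓝 0) := by
        refine Tendsto.const_div_atTop ?_ _
        exact (tendsto_atTop_add_const_right _ _ hS).atTop_mul_const (by positivity)
      refine squeeze_zero_norm' ?_ h1
      filter_upwards [hS.eventually_ge_atTop s, hev] with N hN hle
      have hpos : 0 < (S N + k) * ((k : ℝ) + 1) := by
        have : 0 < S N := hs0.trans_le hN
        positivity
      rw [le_div_iff₀ hpos]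
      refine (hr N k).trans ?_
      gcongr
      exact hle k
  have := tendsto_tsum_of_dominated_convergence hBs hterm hev
  simpa using this

theorem norm_add_natCast_le {A : ℂ} {K : ℝ} (h : ‖A‖ ≤ K) (k : ℕ) : ‖A + k‖ ≤ K + k := by
  refine (norm_add_le _ _).trans ?_
  rw [Complex.norm_natCast]
  linarith

theorem norm_add_natCast_le_of_sub {A B : ℂ} {K : ℝ} (h : ‖A - B‖ ≤ K) (k : ℕ) :
    ‖A + k‖ ≤ ‖B + k‖ + K := by
  have : A + k = (B + k) + (A - B) := by ring
  rw [this]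
  exact (norm_add_le _ _).trans (by linarith)

theorem le_norm_add_natCast {B : ℂ} {r : ℝ} (h : r ≤ B.re) (k : ℕ) : r + k ≤ ‖B + k‖ := by
  have := Complex.re_le_norm (B + k)
  simp at this
  linarith

theorem add_mul_sub_le {q m σ : ℝ} (hm : 0 ≤ m) (hq : σ ≤ q) : (q + m) * (σ - m) ≤ q * σ := by
  nlinarith [mul_nonneg hm (sub_nonneg.2 hq), sq_nonneg m]

/-- Each factor `q + m` is traded for `q` at the cost of one `m` in the last factor. This compares
the large upper parameters, each within `m` of a lower one, with those lower ones. -/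
theorem prod_add_mul_sub_le {q₁ q₂ q₃ m σ b : ℝ} (hm : 0 ≤ m) (h₁ : σ ≤ q₁) (h₂ : σ ≤ q₂)
    (h₃ : σ ≤ q₃) (hb : σ ≤ b) (p₁ : 0 ≤ q₁) (p₂ : 0 ≤ q₂) (p₃ : 0 ≤ q₃) :
    (q₁ + m) * (q₂ + m) * (q₃ + m) * (σ - m - m - m) ≤ q₁ * q₂ * q₃ * b := by
  have s1 := add_mul_sub_le (σ := σ - m - m) hm (by linarith : σ - m - m ≤ q₃)
  have s2 := add_mul_sub_le (σ := σ - m) hm (by linarith : σ - m ≤ q₂)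
  have s3 := add_mul_sub_le hm h₁
  calc (q₁ + m) * (q₂ + m) * (q₃ + m) * (σ - m - m - m)
      = (q₁ + m) * (q₂ + m) * ((q₃ + m) * (σ - m - m - m)) := by ring
    _ ≤ (q₁ + m) * (q₂ + m) * (q₃ * (σ - m - m)) := by gcongr
    _ = (q₁ + m) * q₃ * ((q₂ + m) * (σ - m - m)) := by ring
    _ ≤ (q₁ + m) * q₃ * (q₂ * (σ - m)) := by gcongr
    _ = q₂ * q₃ * ((q₁ + m) * (σ - m)) := by ring
    _ ≤ q₂ * q₃ * (q₁ * σ) := by gcongr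
    _ = q₁ * q₂ * q₃ * σ := by ring
    _ ≤ q₁ * q₂ * q₃ * b := by gcongr

/-- Passes from the exact term ratio to the bound needed for domination. For small `N` the quantity
`σ` may be negative, and the claim is then trivial. -/
theorem mul_le_of_ratio_eq {t t' P Q A κ σ M : ℝ} (ht : 0 ≤ t) (ht' : 0 ≤ t') (hκ : 0 ≤ κ)
    (hP : 0 < P) (hM : 0 ≤ M) (e : P * κ * t' = t * A) (hA : A ≤ M * Q) (hQ : Q * σ ≤ P) :
    t' * (σ * κ) ≤ t * M := by
  rcases le_total σ 0 with hσ | hσ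
  · refine le_trans (mul_nonpos_of_nonneg_of_nonpos ht' ?_) (mul_nonneg ht hM)
    exact mul_nonpos_of_nonpos_of_nonneg hσ hκ
  · refine le_of_mul_le_mul_left ?_ hP
    calc P * (t' * (σ * κ)) = P * κ * t' * σ := by ring
      _ = t * A * σ := by rw [e]
      _ ≤ t * (M * Q) * σ := by gcongr
      _ = t * M * (Q * σ) := by ring
      _ ≤ t * M * P := by gcongr
      _ = P * (t * M) := by ring

/-- The growing upper parameter is paired with `B₂`, leaving two bounded upper parameters against
the growing `B₁`. -/
theorem tendsto_tsum_three_two {A₁ A₃ : ℂ} {A₂ B₁ B₂ : ℕ → ℂ} {K : ℝ} (h₁ : ‖A₁‖ ≤ K)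
    (h₃ : ‖A₃‖ ≤ K) (h₂ : ∀ N, ‖A₂ N - B₂ N‖ ≤ K) (hB₁ : ∀ N : ℕ, N - K ≤ (B₁ N).re)
    (hB₂ : ∀ N : ℕ, N - K ≤ (B₂ N).re) (n₁ : ∀ N, NotNonposInt (B₁ N))
    (n₂ : ∀ N, NotNonposInt (B₂ N)) :
    Tendsto (fun N => ∑' k, hypergeometricTerm [A₁, A₂ N, A₃] [B₁ N, B₂ N] 1 k) atTop (𝓝 1) := by
  have hK : 0 ≤ K := (norm_nonneg _).trans h₁
  refine tendsto_tsum_one_of_ratio_le (S := fun N => N - K - K) hK ?_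
    (fun N => hypergeometricTerm_zero _ _ _) ?_
  · simpa only [sub_eq_add_neg, add_assoc] using
      tendsto_atTop_add_const_right atTop (-K + -K) (tendsto_natCast_atTop_atTop (R := ℝ))
  · intro N k
    have e := congrArg norm (hypergeometricTerm_three_two_succ (j := k) (n₁ N) (n₂ N) (n₁ N) (n₂ N)
      (poch_succ_eq_right k (rfl : A₁ = A₁)) (poch_succ_eq_right k (rfl : A₂ N = A₂ N))
      (poch_succ_eq_right k (rfl : A₃ = A₃)) (poch_succ_eq_right k (rfl : B₁ N = B₁ N))
      (poch_succ_eq_right k (rfl : B₂ N = B₂ N)))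
    simp only [norm_mul, one_mul, mul_one, norm_natCast_add_one] at e
    refine mul_le_of_ratio_eq (Q := ‖B₂ N + k‖ + K) (norm_nonneg _) (norm_nonneg _) (by positivity)
      (mul_pos (norm_pos_iff.2 ((n₁ N).add_ne_zero k)) (norm_pos_iff.2 ((n₂ N).add_ne_zero k)))
      (by positivity) e ?_ ?_
    · calc _ ≤ (K + k) * (‖B₂ N + k‖ + K) * (K + k) := by
            gcongr
            exacts [norm_add_natCast_le h₁ k, norm_add_natCast_le_of_sub (h₂ N) k,
              norm_add_natCast_le h₃ k]
        _ = _ := by ring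
    · have i1 := le_norm_add_natCast (hB₁ N) k
      have i2 := le_norm_add_natCast (hB₂ N) k
      calc _ = (‖B₂ N + k‖ + K) * ((N - K + k) - K) := by ring
        _ ≤ ‖B₂ N + k‖ * (N - K + k) := add_mul_sub_le hK i2
        _ ≤ ‖B₂ N + k‖ * ‖B₁ N + k‖ := by gcongr
        _ = _ := mul_comm _ _

/-- The growing `A₁`, `A₃`, `A₅` are paired with `B₃`, `B₂`, `B₄`; the bounded `A₂`, `A₄` face the
unpaired `B₁`. -/
theorem tendsto_tsum_five_four {A₂ A₄ : ℂ} {A₁ A₃ A₅ B₁ B₂ B₃ B₄ : ℕ → ℂ} {K : ℝ}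
    (h₂ : ‖A₂‖ ≤ K) (h₄ : ‖A₄‖ ≤ K) (h₁ : ∀ N, ‖A₁ N - B₃ N‖ ≤ K) (h₃ : ∀ N, ‖A₃ N - B₂ N‖ ≤ K)
    (h₅ : ∀ N, ‖A₅ N - B₄ N‖ ≤ K) (hB₁ : ∀ N : ℕ, N - K ≤ (B₁ N).re)
    (hB₂ : ∀ N : ℕ, N - K ≤ (B₂ N).re) (hB₃ : ∀ N : ℕ, N - K ≤ (B₃ N).re)
    (hB₄ : ∀ N : ℕ, N - K ≤ (B₄ N).re) (n₁ : ∀ N, NotNonposInt (B₁ N))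
    (n₂ : ∀ N, NotNonposInt (B₂ N)) (n₃ : ∀ N, NotNonposInt (B₃ N))
    (n₄ : ∀ N, NotNonposInt (B₄ N)) :
    Tendsto (fun N => ∑' k, hypergeometricTerm [A₁ N, A₂, A₃ N, A₄, A₅ N]
      [B₁ N, B₂ N, B₃ N, B₄ N] 1 k) atTop (𝓝 1) := by
  have hK : 0 ≤ K := (norm_nonneg _).trans h₂
  refine tendsto_tsum_one_of_ratio_le (S := fun N => N - K - K - K - K) hK ?_
    (fun N => hypergeometricTerm_zero _ _ _) ?_
  · simpa only [sub_eq_add_neg, add_assoc] using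
      tendsto_atTop_add_const_right atTop (-K + (-K + (-K + -K)))
        (tendsto_natCast_atTop_atTop (R := ℝ))
  · intro N k
    have e := congrArg norm (hypergeometricTerm_five_four_succ (j := k) (n₁ N) (n₂ N) (n₃ N) (n₄ N)
      (n₁ N) (n₂ N) (n₃ N) (n₄ N) (poch_succ_eq_right k (rfl : A₁ N = A₁ N))
      (poch_succ_eq_right k (rfl : A₂ = A₂)) (poch_succ_eq_right k (rfl : A₃ N = A₃ N))
      (poch_succ_eq_right k (rfl : A₄ = A₄)) (poch_succ_eq_right k (rfl : A₅ N = A₅ N))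
      (poch_succ_eq_right k (rfl : B₁ N = B₁ N)) (poch_succ_eq_right k (rfl : B₂ N = B₂ N))
      (poch_succ_eq_right k (rfl : B₃ N = B₃ N)) (poch_succ_eq_right k (rfl : B₄ N = B₄ N)))
    simp only [norm_mul, one_mul, mul_one, norm_natCast_add_one] at e
    refine mul_le_of_ratio_eq
      (Q := (‖B₂ N + k‖ + K) * (‖B₃ N + k‖ + K) * (‖B₄ N + k‖ + K))
      (norm_nonneg _) (norm_nonneg _) (by positivity)
      (mul_pos (mul_pos (mul_pos (norm_pos_iff.2 ((n₁ N).add_ne_zero k))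
        (norm_pos_iff.2 ((n₂ N).add_ne_zero k))) (norm_pos_iff.2 ((n₃ N).add_ne_zero k)))
        (norm_pos_iff.2 ((n₄ N).add_ne_zero k)))
      (by positivity) e ?_ ?_
    · calc _ ≤ (‖B₃ N + k‖ + K) * (K + k) * (‖B₂ N + k‖ + K) * (K + k) * (‖B₄ N + k‖ + K) := by
            gcongr
            exacts [norm_add_natCast_le_of_sub (h₁ N) k, norm_add_natCast_le h₂ k,
              norm_add_natCast_le_of_sub (h₃ N) k, norm_add_natCast_le h₄ k,
              norm_add_natCast_le_of_sub (h₅ N) k]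
        _ = _ := by ring
    · have i1 := le_norm_add_natCast (hB₁ N) k
      have i2 := le_norm_add_natCast (hB₂ N) k
      have i3 := le_norm_add_natCast (hB₃ N) k
      have i4 := le_norm_add_natCast (hB₄ N) k
      calc _ = (‖B₂ N + k‖ + K) * (‖B₃ N + k‖ + K) * (‖B₄ N + k‖ + K) *
            ((N - K + k) - K - K - K) := by ring
        _ ≤ ‖B₂ N + k‖ * ‖B₃ N + k‖ * ‖B₄ N + k‖ * ‖B₁ N + k‖ :=
          prod_add_mul_sub_le hK i2 i3 i4 i1 (norm_nonneg _) (norm_nonneg _) (norm_nonneg _)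
        _ = _ := by ring

/-! ### The Gamma factors -/

theorem Gamma_add_natCast_eq {a : ℂ} (ha : NotNonposInt a) (n : ℕ) :
    Complex.Gamma (a + n) = Complex.Gamma a * poch a n := by
  rw [poch, ← Complex.Gamma_add_nat_div_Gamma_eq a ha, mul_div_cancel₀ _ (Complex.Gamma_ne_zero ha)]

/-- Euler's limit for all four values; the powers of `n` cancel because the arguments have equal
sums. -/
theorem tendsto_Gamma_div_Gamma {a₁ a₂ b₁ b₂ : ℂ} (na₁ : NotNonposInt a₁) (na₂ : NotNonposInt a₂)
    (nb₁ : NotNonposInt b₁) (nb₂ : NotNonposInt b₂) (hab : a₁ + a₂ = b₁ + b₂) :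
    Tendsto (fun n : ℕ => Complex.Gamma (a₁ + n) * Complex.Gamma (a₂ + n) /
      (Complex.Gamma (b₁ + n) * Complex.Gamma (b₂ + n))) atTop (𝓝 1) := by
  rw [← tendsto_add_atTop_iff_nat 1]
  have h (a : ℂ) (ha : NotNonposInt a) := (tendsto_poch_div a).const_mul (Complex.Gamma a)
  have g (a : ℂ) (ha : NotNonposInt a) : Complex.Gamma a * (Complex.Gamma a)⁻¹ = 1 :=
    mul_inv_cancel₀ (Complex.Gamma_ne_zero ha)
  have lim := ((h a₁ na₁).mul (h a₂ na₂)).div ((h b₁ nb₁).mul (h b₂ nb₂))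
    (by simp [g b₁ nb₁, g b₂ nb₂])
  rw [g a₁ na₁, g a₂ na₂, g b₁ nb₁, g b₂ nb₂, mul_one, div_one] at lim
  refine lim.congr' ?_
  filter_upwards [eventually_gt_atTop 0] with n hn
  have hn' : (n : ℂ) ≠ 0 := by exact_mod_cast hn.ne'
  have hf : (n.factorial : ℂ) ≠ 0 := by exact_mod_cast n.factorial_ne_zero
  have hc (s : ℂ) : (n : ℂ) ^ s ≠ 0 := by simp [Complex.cpow_eq_zero_iff, hn']
  have hpow : (n : ℂ) ^ a₁ * (n : ℂ) ^ a₂ = (n : ℂ) ^ b₁ * (n : ℂ) ^ b₂ := by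
    rw [← Complex.cpow_add _ _ hn', ← Complex.cpow_add _ _ hn', hab]
  have p1 := poch_ne_zero nb₁ (n + 1)
  have p2 := poch_ne_zero nb₂ (n + 1)
  have q1 := Complex.Gamma_ne_zero nb₁
  have q2 := Complex.Gamma_ne_zero nb₂
  have ca₁ := hc a₁
  have ca₂ := hc a₂
  have cb₁ := hc b₁
  have cb₂ := hc b₂
  simp only [Pi.div_apply, Gamma_add_natCast_eq na₁, Gamma_add_natCast_eq na₂,
    Gamma_add_natCast_eq nb₁, Gamma_add_natCast_eq nb₂]
  generalize (n : ℂ) ^ a₁ = w₁ at *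
  generalize (n : ℂ) ^ a₂ = w₂ at *
  generalize (n : ℂ) ^ b₁ = w₃ at *
  generalize (n : ℂ) ^ b₂ = w₄ at *
  rw [div_eq_div_iff (by positivity) (by positivity)]
  field_simp
  linear_combination -(Complex.Gamma a₁ * poch a₁ (n + 1) * Complex.Gamma a₂ *
    poch a₂ (n + 1)) * hpow

/-- The Gamma quotient relating the `₃F₂` series to the well-poised `₅F₄` series. -/
noncomputable def gammaFactor (h x y : ℂ) : ℂ :=
  (Complex.Gamma h * Complex.Gamma (h + x + y) /
      (Complex.Gamma (h + y) * Complex.Gamma (h + x))) *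
    (Complex.Gamma (2 * h - x + y) * Complex.Gamma (2 * h - 2 * y) /
      (Complex.Gamma (2 * h - x) * Complex.Gamma (2 * h - y)))

/-- The Gamma quotient relating the two companion series. -/
noncomputable def gammaFactorCompanion (h x y : ℂ) : ℂ :=
  (Complex.Gamma (h + 1) * Complex.Gamma (h + x + y + 1) /
      (Complex.Gamma (h + y + 1) * Complex.Gamma (h + x + 1))) *
    (Complex.Gamma (2 * h - x + y + 2) * Complex.Gamma (2 * h - 2 * y + 1) /
      (Complex.Gamma (2 * h - x + 2) * Complex.Gamma (2 * h - y + 1)))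

theorem Gamma_add_two {s : ℂ} (h0 : s ≠ 0) (h1 : s + 1 ≠ 0) :
    Complex.Gamma (s + 2) = (s + 1) * (s * Complex.Gamma s) := by
  rw [← Complex.Gamma_add_one s h0, ← Complex.Gamma_add_one (s + 1) h1, add_assoc,
    one_add_one_eq_two]

theorem tendsto_linear_div_linear (h c₁ d₁ c₂ d₂ : ℂ) (hc : c₂ ≠ 0) :
    Tendsto (fun N : ℕ => (c₁ * (h + N) + d₁) / (c₂ * (h + N) + d₂)) atTop (𝓝 (c₁ / c₂)) := by
  have l (c d : ℂ) : Tendsto (fun N : ℕ => (c * (h + N) + d) / (N : ℂ)) atTop (𝓝 c) := by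
    have h1 := (tendsto_const_div_atTop_nhds_zero_nat (c * h + d)).const_add c
    rw [add_zero] at h1
    refine h1.congr' ?_
    filter_upwards [eventually_gt_atTop 0] with n hn
    have hn' : (n : ℂ) ≠ 0 := by exact_mod_cast hn.ne'
    field_simp
    ring
  refine ((l c₁ d₁).div (l c₂ d₂) hc).congr' ?_
  filter_upwards [eventually_gt_atTop 0] with n hn
  have hn' : (n : ℂ) ≠ 0 := by exact_mod_cast hn.ne'
  simp only [Pi.div_apply]
  rw [div_div_div_cancel_right₀ hn']

namespace Admissible

variable {h x y : ℂ}

theorem notNonposInt (H : Admissible h x y) : NotNonposInt h := by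
  intro m hm
  have h1 := H.re_half
  have h0 := H.ne_zero
  cases m with
  | zero => exact h0 (by simpa using hm)
  | succ m =>
    rw [hm] at h1
    have : (0 : ℝ) ≤ m := m.cast_nonneg
    simp at h1
    linarith

theorem notNonposInt_two_sub (H : Admissible h x y) : NotNonposInt (2 * h - 2 * y) := by
  refine notNonposInt_of_re_pos ?_
  have := H.re_sub
  simp at this ⊢
  linarith

/-- Only `Γ(s + 1) = s Γ(s)`. With `gammaFactor_add_one` it supplies the ratios that convert the ₅F₄
coefficients into the ₃F₂ ones. -/
theorem gammaFactorCompanion_eq (H : Admissible h x y) :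
    (2 * h - x) * (2 * h - x + 1) * (h + x) * (2 * h - y) * (h + y) *
        gammaFactorCompanion h x y =
      2 * h * ((h - y) * ((2 * h - x + y) * (2 * h - x + y + 1) * (h + x + y))) *
        gammaFactor h x y := by
  have a1 := Complex.Gamma_add_one h H.ne_zero
  have a2 := Complex.Gamma_add_one _ H.addAdd.ne_zero
  have a3 := Complex.Gamma_add_one _ H.add_right.ne_zero
  have a4 := Complex.Gamma_add_one _ H.add_left.ne_zero
  have a5 := Gamma_add_two H.twoSubAdd.ne_zero (by simpa using H.twoSubAdd.add_ne_zero 1)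
  have a6 := Complex.Gamma_add_one _ H.notNonposInt_two_sub.ne_zero
  have a7 := Gamma_add_two H.twoSub_left.ne_zero (by simpa using H.twoSub_left.add_ne_zero 1)
  have a8 := Complex.Gamma_add_one _ H.twoSub_right.ne_zero
  have g1 := Complex.Gamma_ne_zero H.add_right
  have g2 := Complex.Gamma_ne_zero H.add_left
  have g3 := Complex.Gamma_ne_zero H.twoSub_left
  have g4 := Complex.Gamma_ne_zero H.twoSub_right
  have z1 := H.add_right.ne_zero
  have z2 := H.add_left.ne_zero
  have z3 := H.twoSub_left.ne_zero
  have z4 := H.twoSub_right.ne_zero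
  have z5 : 2 * h - x + 1 ≠ 0 := by simpa using H.twoSub_left.add_ne_zero 1
  rw [gammaFactorCompanion, gammaFactor, a1, a2, a3, a4, a5, a6, a7, a8]
  generalize Complex.Gamma (h + y) = G1 at *
  generalize Complex.Gamma (h + x) = G2 at *
  generalize Complex.Gamma (2 * h - x) = G3 at *
  generalize Complex.Gamma (2 * h - y) = G4 at *
  generalize Complex.Gamma h = G5 at *
  generalize Complex.Gamma (h + x + y) = G6 at *
  generalize Complex.Gamma (2 * h - x + y) = G7 at *
  generalize Complex.Gamma (2 * h - 2 * y) = G8 at *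
  rw [show 2 * h - 2 * y = 2 * (h - y) by ring]
  -- The order matters: a sum such as `h + x + y` must be abstracted before its subterm `h + x`.
  generalize h + y = k1 at *
  generalize h + x + y = k5 at *
  generalize h + x = k2 at *
  generalize 2 * h - x + 1 = k4 at *
  generalize 2 * h - x + y + 1 = k6 at *
  generalize 2 * h - x + y = k7 at *
  generalize 2 * h - x = k3 at *
  generalize 2 * h - y = k8 at *
  generalize h - y = k9 at *
  field_simp

theorem gammaFactor_add_one (H : Admissible h x y) :
    (2 * h - y + 1) * gammaFactor (h + 1) x y =
      (2 * h - 2 * y + 1) * gammaFactorCompanion h x y := by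
  have z1 : 2 * h - y + 1 ≠ 0 := H.twoSub_right_companion.ne_zero
  have z2 : 2 * h - 2 * y + 1 ≠ 0 := by simpa using H.notNonposInt_two_sub.add_ne_zero 1
  have a1 := Complex.Gamma_add_one _ z1
  have a2 := Complex.Gamma_add_one _ z2
  have g1 := Complex.Gamma_ne_zero H.twoSub_right_companion
  rw [gammaFactor, gammaFactorCompanion, show h + 1 + x + y = h + x + y + 1 by ring,
    show h + 1 + y = h + y + 1 by ring, show h + 1 + x = h + x + 1 by ring,
    show 2 * (h + 1) - x + y = 2 * h - x + y + 2 by ring,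
    show 2 * (h + 1) - 2 * y = 2 * h - 2 * y + 1 + 1 by ring,
    show 2 * (h + 1) - x = 2 * h - x + 2 by ring,
    show 2 * (h + 1) - y = 2 * h - y + 1 + 1 by ring, a1, a2]
  generalize 2 * h - y + 1 = k1 at *
  generalize 2 * h - 2 * y + 1 = k2 at *
  generalize Complex.Gamma k1 = G1 at *
  field_simp

theorem tendsto_gammaFactor (H : Admissible h x y) :
    Tendsto (fun N : ℕ => gammaFactor (h + N) x y) atTop (𝓝 1) := by
  have l1 := tendsto_Gamma_div_Gamma H.notNonposInt H.addAdd H.add_right H.add_left (by ring)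
  -- These arguments contain `2h` and move by `2N`, hence the limit along even integers.
  have l2 := (tendsto_Gamma_div_Gamma H.twoSubAdd H.notNonposInt_two_sub H.twoSub_left
    H.twoSub_right (by ring)).comp (tendsto_id.const_mul_atTop' two_pos)
  have l3 := l1.mul l2
  rw [mul_one] at l3
  refine l3.congr fun N => ?_
  simp only [gammaFactor, Function.comp, id, Nat.cast_mul, Nat.cast_ofNat]
  rw [show h + N + x + y = h + x + y + N by ring, show h + N + y = h + y + N by ring,
    show h + N + x = h + x + N by ring,
    show 2 * (h + N) - x + y = 2 * h - x + y + 2 * N by ring,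
    show 2 * (h + N) - 2 * y = 2 * h - 2 * y + 2 * N by ring,
    show 2 * (h + N) - x = 2 * h - x + 2 * N by ring,
    show 2 * (h + N) - y = 2 * h - y + 2 * N by ring]

theorem tendsto_gammaFactorCompanion (H : Admissible h x y) :
    Tendsto (fun N : ℕ => gammaFactorCompanion (h + N) x y) atTop (𝓝 1) := by
  have l1 := tendsto_Gamma_div_Gamma (H.notNonposInt.add_natCast 1) (H.addAdd.add_natCast 1)
    (H.add_right.add_natCast 1) (H.add_left.add_natCast 1) (by ring)
  have l2 := (tendsto_Gamma_div_Gamma (H.twoSubAdd.add_natCast 2)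
    (H.notNonposInt_two_sub.add_natCast 1) (H.twoSub_left.add_natCast 2)
    (H.twoSub_right.add_natCast 1) (by push_cast; ring)).comp (tendsto_id.const_mul_atTop' two_pos)
  have l3 := l1.mul l2
  rw [mul_one] at l3
  refine l3.congr fun N => ?_
  simp only [gammaFactorCompanion, Function.comp, id, Nat.cast_mul, Nat.cast_ofNat, Nat.cast_one]
  rw [show h + N + 1 = h + 1 + N by ring, show h + N + x + y + 1 = h + x + y + 1 + N by ring,
    show h + N + y + 1 = h + y + 1 + N by ring,
    show h + N + x + 1 = h + x + 1 + N by ring,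
    show 2 * (h + N) - x + y + 2 = 2 * h - x + y + 2 + 2 * N by ring,
    show 2 * (h + N) - 2 * y + 1 = 2 * h - 2 * y + 1 + 2 * N by ring,
    show 2 * (h + N) - x + 2 = 2 * h - x + 2 + 2 * N by ring,
    show 2 * (h + N) - y + 1 = 2 * h - y + 1 + 2 * N by ring]

end Admissible

/-! ### The transformation formula -/

/-- One constant `K` serves for all four limits: every bounded parameter or paired difference is
such an affine form in `h`, `x`, `y`. -/
theorem norm_le_of_four {h x y : ℂ} {s t u v : ℝ} (hs : |s| ≤ 2) (ht : |t| ≤ 2) (hu : |u| ≤ 2)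
    (hv : |v| ≤ 3) : ‖s * h + t * x + u * y + v‖ ≤ 2 * ‖h‖ + 2 * ‖x‖ + 2 * ‖y‖ + 3 := by
  have b (r : ℝ) (z : ℂ) (hr : |r| ≤ 2) : ‖(r : ℂ) * z‖ ≤ 2 * ‖z‖ := by
    rw [norm_mul, Complex.norm_real, Real.norm_eq_abs]
    gcongr
  have b1 := b s h hs
  have b2 := b t x ht
  have b3 := b u y hu
  have b4 : ‖(v : ℂ)‖ ≤ 3 := by rwa [Complex.norm_real, Real.norm_eq_abs]
  linarith [norm_add₃_le (a := (s : ℂ) * h) (b := t * x) (c := u * y),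
    norm_add_le (s * h + t * x + u * y) (v : ℂ)]

theorem natCast_sub_le_re {K : ℝ} {z : ℂ} (hz : ‖z‖ ≤ K) {c : ℝ} (hc : 1 ≤ c) {w : ℂ} {N : ℕ}
    (hw : w = z + c * N) : (N : ℝ) - K ≤ w.re := by
  have h1 := (abs_le.mp ((Complex.abs_re_le_norm z).trans hz)).1
  have h2 : w.re = z.re + c * N := by simp [hw]
  have h3 : (0 : ℝ) ≤ N := N.cast_nonneg
  nlinarith

namespace Admissible

variable {h x y : ℂ}

theorem tendsto_tsum_threeTerm (H : Admissible h x y) :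
    Tendsto (fun N : ℕ => ∑' k, threeTerm (h + N) x y k) atTop (𝓝 1) := by
  refine tendsto_tsum_three_two (K := 2 * ‖h‖ + 2 * ‖x‖ + 2 * ‖y‖ + 3) ?_ ?_ (fun N => ?_)
    (fun N => ?_) (fun N => ?_) (fun N => (H.add_natCast N).twoSubAdd)
    (fun N => (H.add_natCast N).addAdd)
  · convert norm_le_of_four (h := h) (x := x) (y := y) (s := 0) (t := 0) (u := 2) (v := 0)
      (by norm_num) (by norm_num) (by norm_num) (by norm_num) using 2
    push_cast; ring
  · convert norm_le_of_four (h := h) (x := x) (y := y) (s := 0) (t := 1) (u := 1) (v := 0)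
      (by norm_num) (by norm_num) (by norm_num) (by norm_num) using 2
    push_cast; ring
  · convert norm_le_of_four (h := h) (x := x) (y := y) (s := 0) (t := -2) (u := 0) (v := 0)
      (by norm_num) (by norm_num) (by norm_num) (by norm_num) using 2
    push_cast; ring
  · exact natCast_sub_le_re (norm_le_of_four (h := h) (x := x) (y := y) (s := 2) (t := -1) (u := 1)
      (v := 0) (by norm_num) (by norm_num) (by norm_num) (by norm_num)) one_le_two
      (by push_cast; ring)
  · exact natCast_sub_le_re (norm_le_of_four (h := h) (x := x) (y := y) (s := 1) (t := 1) (u := 1)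
      (v := 0) (by norm_num) (by norm_num) (by norm_num) (by norm_num)) le_rfl (by push_cast; ring)

theorem tendsto_tsum_threeTermCompanion (H : Admissible h x y) :
    Tendsto (fun N : ℕ => ∑' k, threeTermCompanion (h + N) x y k) atTop (𝓝 1) := by
  refine tendsto_tsum_three_two (K := 2 * ‖h‖ + 2 * ‖x‖ + 2 * ‖y‖ + 3) ?_ ?_ (fun N => ?_)
    (fun N => ?_) (fun N => ?_) (fun N => (H.add_natCast N).twoSubAdd_companion)
    (fun N => (H.add_natCast N).addAdd_companion)
  · convert norm_le_of_four (h := h) (x := x) (y := y) (s := 0) (t := 0) (u := 2) (v := 1)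
      (by norm_num) (by norm_num) (by norm_num) (by norm_num) using 2
    push_cast; ring
  · convert norm_le_of_four (h := h) (x := x) (y := y) (s := 0) (t := 1) (u := 1) (v := 0)
      (by norm_num) (by norm_num) (by norm_num) (by norm_num) using 2
    push_cast; ring
  · convert norm_le_of_four (h := h) (x := x) (y := y) (s := 0) (t := -2) (u := 0) (v := 0)
      (by norm_num) (by norm_num) (by norm_num) (by norm_num) using 2
    push_cast; ring
  · exact natCast_sub_le_re (norm_le_of_four (h := h) (x := x) (y := y) (s := 2) (t := -1) (u := 1)
      (v := 2) (by norm_num) (by norm_num) (by norm_num) (by norm_num)) one_le_two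
      (by push_cast; ring)
  · exact natCast_sub_le_re (norm_le_of_four (h := h) (x := x) (y := y) (s := 1) (t := 1) (u := 1)
      (v := 1) (by norm_num) (by norm_num) (by norm_num) (by norm_num)) le_rfl (by push_cast; ring)

theorem tendsto_tsum_fiveTerm (H : Admissible h x y) :
    Tendsto (fun N : ℕ => ∑' k, fiveTerm (h + N) x y k) atTop (𝓝 1) := by
  refine tendsto_tsum_five_four (K := 2 * ‖h‖ + 2 * ‖x‖ + 2 * ‖y‖ + 3) ?_ ?_ (fun N => ?_)
    (fun N => ?_) (fun N => ?_) (fun N => ?_) (fun N => ?_) (fun N => ?_) (fun N => ?_)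
    (fun N => (H.add_natCast N).twoSub_left) (fun N => (H.add_natCast N).add_left)
    (fun N => (H.add_natCast N).twoSub_right) (fun N => (H.add_natCast N).add_right)
  · convert norm_le_of_four (h := h) (x := x) (y := y) (s := 0) (t := 1) (u := 0) (v := 0)
      (by norm_num) (by norm_num) (by norm_num) (by norm_num) using 2
    push_cast; ring
  · convert norm_le_of_four (h := h) (x := x) (y := y) (s := 0) (t := 0) (u := 1) (v := 0)
      (by norm_num) (by norm_num) (by norm_num) (by norm_num) using 2
    push_cast; ring
  · convert norm_le_of_four (h := h) (x := x) (y := y) (s := 0) (t := 0) (u := 1) (v := -1)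
      (by norm_num) (by norm_num) (by norm_num) (by norm_num) using 2
    push_cast; ring
  · convert norm_le_of_four (h := h) (x := x) (y := y) (s := 0) (t := -2) (u := 0) (v := 0)
      (by norm_num) (by norm_num) (by norm_num) (by norm_num) using 2
    push_cast; ring
  · convert norm_le_of_four (h := h) (x := x) (y := y) (s := 0) (t := 0) (u := -2) (v := 0)
      (by norm_num) (by norm_num) (by norm_num) (by norm_num) using 2
    push_cast; ring
  · exact natCast_sub_le_re (norm_le_of_four (h := h) (x := x) (y := y) (s := 2) (t := -1) (u := 0)
      (v := 0) (by norm_num) (by norm_num) (by norm_num) (by norm_num)) one_le_two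
      (by push_cast; ring)
  · exact natCast_sub_le_re (norm_le_of_four (h := h) (x := x) (y := y) (s := 1) (t := 1) (u := 0)
      (v := 0) (by norm_num) (by norm_num) (by norm_num) (by norm_num)) le_rfl (by push_cast; ring)
  · exact natCast_sub_le_re (norm_le_of_four (h := h) (x := x) (y := y) (s := 2) (t := 0) (u := -1)
      (v := 0) (by norm_num) (by norm_num) (by norm_num) (by norm_num)) one_le_two
      (by push_cast; ring)
  · exact natCast_sub_le_re (norm_le_of_four (h := h) (x := x) (y := y) (s := 1) (t := 0) (u := 1)
      (v := 0) (by norm_num) (by norm_num) (by norm_num) (by norm_num)) le_rfl (by push_cast; ring)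

theorem tendsto_tsum_fiveTermCompanion (H : Admissible h x y) :
    Tendsto (fun N : ℕ => ∑' k, fiveTermCompanion (h + N) x y k) atTop (𝓝 1) := by
  refine tendsto_tsum_five_four (K := 2 * ‖h‖ + 2 * ‖x‖ + 2 * ‖y‖ + 3) ?_ ?_ (fun N => ?_)
    (fun N => ?_) (fun N => ?_) (fun N => ?_) (fun N => ?_) (fun N => ?_) (fun N => ?_)
    (fun N => (H.add_natCast N).twoSub_left_companion)
    (fun N => (H.add_natCast N).add_left_companion)
    (fun N => (H.add_natCast N).twoSub_right_companion)
    (fun N => (H.add_natCast N).add_right_companion)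
  · convert norm_le_of_four (h := h) (x := x) (y := y) (s := 0) (t := 1) (u := 0) (v := 0)
      (by norm_num) (by norm_num) (by norm_num) (by norm_num) using 2
    push_cast; ring
  · convert norm_le_of_four (h := h) (x := x) (y := y) (s := 0) (t := 0) (u := 1) (v := 1)
      (by norm_num) (by norm_num) (by norm_num) (by norm_num) using 2
    push_cast; ring
  · convert norm_le_of_four (h := h) (x := x) (y := y) (s := 0) (t := 0) (u := 1) (v := 0)
      (by norm_num) (by norm_num) (by norm_num) (by norm_num) using 2
    push_cast; ring
  · convert norm_le_of_four (h := h) (x := x) (y := y) (s := 0) (t := -2) (u := 0) (v := 0)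
      (by norm_num) (by norm_num) (by norm_num) (by norm_num) using 2
    push_cast; ring
  · convert norm_le_of_four (h := h) (x := x) (y := y) (s := 0) (t := 0) (u := -2) (v := 0)
      (by norm_num) (by norm_num) (by norm_num) (by norm_num) using 2
    push_cast; ring
  · exact natCast_sub_le_re (norm_le_of_four (h := h) (x := x) (y := y) (s := 2) (t := -1) (u := 0)
      (v := 2) (by norm_num) (by norm_num) (by norm_num) (by norm_num)) one_le_two
      (by push_cast; ring)
  · exact natCast_sub_le_re (norm_le_of_four (h := h) (x := x) (y := y) (s := 1) (t := 1) (u := 0)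
      (v := 1) (by norm_num) (by norm_num) (by norm_num) (by norm_num)) le_rfl (by push_cast; ring)
  · exact natCast_sub_le_re (norm_le_of_four (h := h) (x := x) (y := y) (s := 2) (t := 0) (u := -1)
      (v := 1) (by norm_num) (by norm_num) (by norm_num) (by norm_num)) one_le_two
      (by push_cast; ring)
  · exact natCast_sub_le_re (norm_le_of_four (h := h) (x := x) (y := y) (s := 1) (t := 0) (u := 1)
      (v := 1) (by norm_num) (by norm_num) (by norm_num) (by norm_num)) le_rfl (by push_cast; ring)

/-- The rescaled ₅F₄ pair satisfies `threeTerm_relation` coefficient for coefficient. -/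
theorem gammaFactor_mul_fiveTerm_relation (H : Admissible h x y) :
    (h - y) * ((2 * h - x + y) * (2 * h - x + y + 1) * (h + x + y)) *
        (gammaFactor h x y * ∑' k, fiveTerm h x y k) =
      h * (2 * h - x) * (h + x - y) * (2 * h - x - y + 1) *
        (gammaFactor (h + 1) x y * ∑' k, fiveTerm (h + 1) x y k) +
      h * y * (10 * h ^ 2 - 6 * h * (x + y) + 4 * x * y + 3 * h - x - y) *
        (gammaFactorCompanion h x y * ∑' k, fiveTermCompanion h x y k) := by
  have e1 := H.gammaFactorCompanion_eq
  have e2 := H.gammaFactor_add_one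
  have e3 := H.fiveTerm_relation
  have z1 := H.ne_zero
  have z2 := H.twoSub_right_companion.ne_zero
  generalize (h - y) * ((2 * h - x + y) * (2 * h - x + y + 1) * (h + x + y)) = p at *
  generalize 10 * h ^ 2 - 6 * h * (x + y) + 4 * x * y + 3 * h - x - y = Q at *
  generalize 2 * h - y + 1 = m at *
  generalize 2 * h - 2 * y + 1 = n at *
  generalize 2 * h - x + 1 = k₁ at *
  generalize 2 * h - x - y + 1 = k₂ at *
  generalize 2 * h - x = k₃ at *
  generalize 2 * h - y = k₄ at *
  generalize h + x - y = k₅ at *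
  generalize h + x = k₆ at *
  generalize h + y = k₇ at *
  generalize gammaFactor h x y = C at *
  generalize gammaFactor (h + 1) x y = C₁ at *
  generalize gammaFactorCompanion h x y = C' at *
  generalize ∑' k, fiveTerm h x y k = G at *
  generalize ∑' k, fiveTerm (h + 1) x y k = G₁ at *
  generalize ∑' k, fiveTermCompanion h x y k = K at *
  -- The factor `2h(2h - y + 1)` clears what the two Gamma identities would divide by.
  refine mul_left_cancel₀ (mul_ne_zero (mul_ne_zero two_ne_zero z1) z2) ?_
  linear_combination -(m * G) * e1 + C' * e3 - 2 * h ^ 2 * k₃ * k₅ * k₂ * G₁ * e2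

theorem gammaFactorCompanion_mul_fiveTermCompanion_relation (H : Admissible h x y) :
    (2 * h - 2 * y + 1) * (2 * h - x + 2) *
      ((2 * h - x + y + 2) * (2 * h - x + y + 3) * (h + x + y + 1)) *
        (gammaFactorCompanion h x y * ∑' k, fiveTermCompanion h x y k) =
      (5 * h ^ 2 + 8 * h + 3 - 3 * h * x - 3 * h * y - 2 * x - 3 * y + 2 * x * y) *
      ((2 * h - x + y + 2) * (2 * h - x + y + 3) * (h + x + y + 1)) *
        (gammaFactor (h + 1) x y * ∑' k, fiveTerm (h + 1) x y k) +
      -((h + 1) * (2 * h - 2 * x + 3) * (h - x + 1) * (2 * h - x - y + 2) * (h - x + y + 1)) *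
        (gammaFactorCompanion (h + 1) x y * ∑' k, fiveTermCompanion (h + 1) x y k) := by
  have e1 := H.add_one.gammaFactorCompanion_eq
  have e2 := H.gammaFactor_add_one
  have e3 := H.fiveTermCompanion_relation
  have z1 := H.twoSub_left_companion.ne_zero
  have z2 : 2 * h - x + 3 ≠ 0 := by
    have := H.twoSub_left.add_ne_zero 3
    simpa using this
  have z3 := H.add_left_companion.ne_zero
  have z4 : 2 * h - y + 2 ≠ 0 := by
    have := H.twoSub_right.add_ne_zero 2
    simpa using this
  have z5 := H.add_right_companion.ne_zero
  rw [show 2 * (h + 1) - x + 1 = 2 * h - x + 3 by ring,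
    show 2 * (h + 1) - x + y + 1 = 2 * h - x + y + 3 by ring,
    show 2 * (h + 1) - x + y = 2 * h - x + y + 2 by ring,
    show h + 1 + x + y = h + x + y + 1 by ring,
    show 2 * (h + 1) - x = 2 * h - x + 2 by ring, show 2 * (h + 1) - y = 2 * h - y + 2 by ring,
    show h + 1 + x = h + x + 1 by ring, show h + 1 + y = h + y + 1 by ring,
    show h + 1 - y = h - y + 1 by ring] at e1
  generalize 5 * h ^ 2 + 8 * h + 3 - 3 * h * x - 3 * h * y - 2 * x - 3 * y + 2 * x * y = S at *
  generalize gammaFactor (h + 1) x y = C₁ at *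
  generalize gammaFactorCompanion h x y = C' at *
  generalize gammaFactorCompanion (h + 1) x y = C₁' at *
  generalize ∑' k, fiveTerm (h + 1) x y k = G₁ at *
  generalize ∑' k, fiveTermCompanion h x y k = K at *
  generalize ∑' k, fiveTermCompanion (h + 1) x y k = K₁ at *
  generalize 2 * h - x + 2 = k₁ at *
  generalize 2 * h - x + 3 = k₂ at *
  generalize h + x + 1 = k₃ at *
  generalize 2 * h - y + 2 = k₄ at *
  generalize h + y + 1 = k₅ at *
  generalize (2 * h - x + y + 2) * (2 * h - x + y + 3) * (h + x + y + 1) = E at *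
  generalize 2 * h - 2 * x + 3 = k₆ at *
  generalize h - x + 1 = k₇ at *
  generalize 2 * h - x - y + 2 = k₈ at *
  generalize h - x + y + 1 = k₉ at *
  generalize h - y + 1 = l at *
  generalize 2 * h - y + 1 = m at *
  generalize 2 * h - 2 * y + 1 = n at *
  generalize h + 1 = g at *
  refine mul_left_cancel₀ (mul_ne_zero (mul_ne_zero (mul_ne_zero (mul_ne_zero z1 z2) z3) z4) z5) ?_
  linear_combination g * k₆ * k₇ * k₈ * k₉ * K₁ * e1 -
    k₁ * E * (k₁ * k₂ * k₃ * k₄ * k₅) * K * e2 + E * C₁ * e3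

end Admissible

theorem mul_div_mul_rearrange (a₁ a₂ a₃ a₄ a₅ a₆ a₇ a₈ a₉ b₁ b₂ b₃ b₄ b₅ b₆ b₇ b₈ b₉ : ℂ) :
    a₁ * a₂ * a₃ * a₄ / (b₁ * (b₂ * b₃ * b₄)) *
        (-(a₅ * a₆ * a₇ * a₈ * a₉) / (b₅ * b₆ * (b₇ * b₈ * b₉))) =
      -(a₁ / b₁ * (a₂ / b₂) * (a₃ / b₄) * (a₄ / b₃) * (a₅ / b₉) * (a₆ / b₅) * (a₇ / b₇) *
        (a₈ / b₆) * (a₉ / b₈)) := by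
  simp only [div_eq_mul_inv, mul_inv]
  ring

/-- The quantity is `α δ` of the system. Pairing its linear factors gives the limit `-1/4`, with two
ratios contributing `1/2` each and the others `1`. -/
theorem eventually_norm_step_le_one (h x y : ℂ) :
    ∀ᶠ N : ℕ in atTop, ‖(h + N) * (2 * (h + N) - x) * ((h + N) + x - y) *
        (2 * (h + N) - x - y + 1) / (((h + N) - y) * ((2 * (h + N) - x + y) *
          (2 * (h + N) - x + y + 1) * ((h + N) + x + y))) *
      (-(((h + N) + 1) * (2 * (h + N) - 2 * x + 3) * ((h + N) - x + 1) *
        (2 * (h + N) - x - y + 2) * ((h + N) - x + y + 1)) /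
        ((2 * (h + N) - 2 * y + 1) * (2 * (h + N) - x + 2) * ((2 * (h + N) - x + y + 2) *
          (2 * (h + N) - x + y + 3) * ((h + N) + x + y + 1))))‖ ≤ 1 := by
  have l (c₁ d₁ c₂ d₂ : ℂ) (hc : c₂ ≠ 0) := tendsto_linear_div_linear h c₁ d₁ c₂ d₂ hc
  have lim := (((((((((l 1 0 1 (-y) one_ne_zero).mul (l 2 (-x) 2 (-x + y) two_ne_zero)).mul
    (l 1 (x - y) 1 (x + y) one_ne_zero)).mul (l 2 (-x - y + 1) 2 (-x + y + 1) two_ne_zero)).mul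
    (l 1 1 1 (x + y + 1) one_ne_zero)).mul (l 2 (-2 * x + 3) 2 (-2 * y + 1) two_ne_zero)).mul
    (l 1 (-x + 1) 2 (-x + y + 2) two_ne_zero)).mul (l 2 (-x - y + 2) 2 (-x + 2) two_ne_zero)).mul
    (l 1 (-x + y + 1) 2 (-x + y + 3) two_ne_zero)).neg.norm
  have hlt : ‖-((1 : ℂ) / 1 * (2 / 2) * (1 / 1) * (2 / 2) * (1 / 1) * (2 / 2) * (1 / 2) * (2 / 2) *
      (1 / 2))‖ < 1 := by norm_num
  filter_upwards [lim.eventually_le_const hlt] with N hN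
  rw [mul_div_mul_rearrange]
  simpa only [one_mul, add_zero, neg_mul, ← add_assoc, ← add_sub_assoc, ← sub_eq_add_neg] using hN

namespace Admissible

variable {h x y : ℂ}

theorem tsum_threeTerm_eq (H : Admissible h x y) :
    ∑' k, threeTerm h x y k = gammaFactor h x y * ∑' k, fiveTerm h x y k := by
  have hs (N : ℕ) : h + ((N + 1 : ℕ) : ℂ) = h + N + 1 := by push_cast; ring
  have np (N : ℕ) : ((h + N) - y) * ((2 * (h + N) - x + y) *
      (2 * (h + N) - x + y + 1) * ((h + N) + x + y)) ≠ 0 := by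
    have H' := H.add_natCast N
    have := H'.twoSubAdd.add_ne_zero 1
    have h0 : h + N - y ≠ 0 := fun h0 => by simpa [h0] using H'.re_sub
    exact mul_ne_zero h0 (mul_ne_zero (mul_ne_zero H'.twoSubAdd.ne_zero (by simpa using this))
      H'.addAdd.ne_zero)
  have nE (N : ℕ) : (2 * (h + N) - x + y + 2) * (2 * (h + N) - x + y + 3) *
      ((h + N) + x + y + 1) ≠ 0 := by
    have H' := H.add_natCast N
    have := H'.twoSubAdd.add_ne_zero 3
    exact mul_ne_zero (mul_ne_zero H'.twoSubAdd_companion.ne_zero (by simpa using this))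
      H'.addAdd_companion.ne_zero
  have nq (N : ℕ) : (2 * (h + N) - 2 * y + 1) * (2 * (h + N) - x + 2) ≠ 0 := by
    have H' := H.add_natCast N
    have := H'.notNonposInt_two_sub.add_ne_zero 1
    exact mul_ne_zero (by simpa using this) H'.twoSub_left_companion.ne_zero
  -- Dividing by the same nonzero leading coefficients for both solutions makes their systems
  -- literally identical.
  have row {p a b f₀ f₁ l : ℂ} (hp : p ≠ 0) (e : p * f₀ = a * f₁ + b * l) :
      f₀ = a / p * f₁ + b / p * l := by
    field_simp
    rw [mul_comm, e]
  have key := eq_of_linear_system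
    (f := fun N => ∑' k, threeTerm (h + N) x y k)
    (l := fun N => ∑' k, threeTermCompanion (h + N) x y k)
    (u := fun N => gammaFactor (h + N) x y * ∑' k, fiveTerm (h + N) x y k)
    (v := fun N => gammaFactorCompanion (h + N) x y * ∑' k, fiveTermCompanion (h + N) x y k)
    (fun N => by
      simpa only [hs] using row (np N) (H.add_natCast N).threeTerm_relation)
    (fun N => by
      simpa only [hs] using row (mul_ne_zero (nq N) (nE N))
        (H.add_natCast N).threeTermCompanion_relation)
    (fun N => by
      simpa only [hs] using row (np N) (H.add_natCast N).gammaFactor_mul_fiveTerm_relation)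
    (fun N => by
      simpa only [hs] using row (mul_ne_zero (nq N) (nE N))
        (H.add_natCast N).gammaFactorCompanion_mul_fiveTermCompanion_relation)
    (eventually_norm_step_le_one h x y)
    H.tendsto_tsum_threeTerm H.tendsto_tsum_threeTermCompanion
    (by simpa using H.tendsto_gammaFactor.mul H.tendsto_tsum_fiveTerm)
    (by simpa using H.tendsto_gammaFactorCompanion.mul H.tendsto_tsum_fiveTermCompanion) 0
  simpa using key

end Admissible

/-- The duplication formula, with the elementary factor isolated. -/
theorem Gamma_duplication (s : ℂ) : Complex.Gamma s * Complex.Gamma (s + 1 / 2) =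
    Complex.Gamma (2 * s) * (2 ^ (1 - 2 * s) * (Real.sqrt Real.pi : ℂ)) := by
  rw [Complex.Gamma_mul_Gamma_add_half, mul_assoc]

theorem duplication_factor_ne_zero (s : ℂ) :
    (2 : ℂ) ^ (1 - 2 * s) * (Real.sqrt Real.pi : ℂ) ≠ 0 := by
  refine mul_ne_zero (by simp [Complex.cpow_eq_zero_iff]) ?_
  exact_mod_cast (Real.sqrt_pos.mpr Real.pi_pos).ne'

/-- Cross-ratio of Gamma values expressed through the duplication formula. -/
theorem Gamma_ratio_eq_duplication {s₁ s₂ s₃ s₄ : ℂ} (hs : s₁ + s₃ = s₂ + s₄)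
    (n₁ : NotNonposInt (2 * s₁)) (n₃ : NotNonposInt (2 * s₃)) (n₂ : NotNonposInt s₂)
    (n₄ : NotNonposInt s₄) (m₂ : NotNonposInt (s₂ + 1 / 2)) (m₄ : NotNonposInt (s₄ + 1 / 2)) :
    Complex.Gamma s₁ * Complex.Gamma s₃ / (Complex.Gamma s₂ * Complex.Gamma s₄) =
      Complex.Gamma (s₂ + 1 / 2) * Complex.Gamma (s₄ + 1 / 2) /
        (Complex.Gamma (s₁ + 1 / 2) * Complex.Gamma (s₃ + 1 / 2)) *
      (Complex.Gamma (2 * s₁) * Complex.Gamma (2 * s₃) /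
        (Complex.Gamma (2 * s₂) * Complex.Gamma (2 * s₄))) := by
  have d₁ := Gamma_duplication s₁
  have d₂ := Gamma_duplication s₂
  have d₃ := Gamma_duplication s₃
  have d₄ := Gamma_duplication s₄
  have w₁ := duplication_factor_ne_zero s₁
  have w₃ := duplication_factor_ne_zero s₃
  -- The elementary duplication factors cancel because `s₁ + s₃ = s₂ + s₄`.
  have hw : (2 : ℂ) ^ (1 - 2 * s₁) * (Real.sqrt Real.pi : ℂ) *
      ((2 : ℂ) ^ (1 - 2 * s₃) * (Real.sqrt Real.pi : ℂ)) =
      (2 : ℂ) ^ (1 - 2 * s₂) * (Real.sqrt Real.pi : ℂ) *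
      ((2 : ℂ) ^ (1 - 2 * s₄) * (Real.sqrt Real.pi : ℂ)) := by
    rw [mul_mul_mul_comm, mul_mul_mul_comm _ _ ((2 : ℂ) ^ (1 - 2 * s₄)),
      ← Complex.cpow_add _ _ two_ne_zero, ← Complex.cpow_add _ _ two_ne_zero,
      show 1 - 2 * s₁ + (1 - 2 * s₃) = 1 - 2 * s₂ + (1 - 2 * s₄) by linear_combination -2 * hs]
  generalize (2 : ℂ) ^ (1 - 2 * s₁) * (Real.sqrt Real.pi : ℂ) = v₁ at *
  generalize (2 : ℂ) ^ (1 - 2 * s₂) * (Real.sqrt Real.pi : ℂ) = v₂ at *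
  generalize (2 : ℂ) ^ (1 - 2 * s₃) * (Real.sqrt Real.pi : ℂ) = v₃ at *
  generalize (2 : ℂ) ^ (1 - 2 * s₄) * (Real.sqrt Real.pi : ℂ) = v₄ at *
  have A₂ := Complex.Gamma_ne_zero n₂
  have A₄ := Complex.Gamma_ne_zero n₄
  -- Nonvanishing is carried across the duplication formula: from the half-shifted pair to `Γ(2s)`
  -- for `s₂`, `s₄`, and in the opposite direction for `s₁`, `s₃`.
  have p₂ := mul_ne_zero A₂ (Complex.Gamma_ne_zero m₂)
  have p₄ := mul_ne_zero A₄ (Complex.Gamma_ne_zero m₄)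
  have p₁ := mul_ne_zero (Complex.Gamma_ne_zero n₁) w₁
  have p₃ := mul_ne_zero (Complex.Gamma_ne_zero n₃) w₃
  rw [← d₁] at p₁
  rw [← d₃] at p₃
  rw [d₂] at p₂
  rw [d₄] at p₄
  have B₁ := right_ne_zero_of_mul p₁
  have B₃ := right_ne_zero_of_mul p₃
  have D₂ := left_ne_zero_of_mul p₂
  have D₄ := left_ne_zero_of_mul p₄
  generalize Complex.Gamma s₁ = A₁' at *
  generalize Complex.Gamma s₂ = A₂' at *
  generalize Complex.Gamma s₃ = A₃' at *
  generalize Complex.Gamma s₄ = A₄' at *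
  generalize Complex.Gamma (s₁ + 1 / 2) = B₁' at *
  generalize Complex.Gamma (s₂ + 1 / 2) = B₂' at *
  generalize Complex.Gamma (s₃ + 1 / 2) = B₃' at *
  generalize Complex.Gamma (s₄ + 1 / 2) = B₄' at *
  generalize Complex.Gamma (2 * s₁) = D₁' at *
  generalize Complex.Gamma (2 * s₂) = D₂' at *
  generalize Complex.Gamma (2 * s₃) = D₃' at *
  generalize Complex.Gamma (2 * s₄) = D₄' at *
  rw [div_mul_div_comm, div_eq_div_iff (mul_ne_zero A₂ A₄)
    (mul_ne_zero (mul_ne_zero B₁ B₃) (mul_ne_zero D₂ D₄))]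
  refine mul_right_cancel₀ (mul_ne_zero w₁ w₃) ?_
  linear_combination D₂' * D₄' * v₁ * v₃ * (A₃' * B₃' * d₁ + D₁' * v₁ * d₃) -
    D₁' * D₃' * v₁ * v₃ * (A₄' * B₄' * d₂ + D₂' * v₂ * d₄) + D₁' * D₃' * D₂' * D₄' * v₁ * v₃ * hw

/-! ### The transformation in the parameters `a`, `b`, `c` -/

theorem hypergeometricTerm_perm {as as' bs bs' : List ℂ} (ha : as.Perm as') (hb : bs.Perm bs')
    (z : ℂ) : hypergeometricTerm as bs z = hypergeometricTerm as' bs' z := by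
  funext k
  rw [hypergeometricTerm, hypergeometricTerm, (ha.map _).prod_eq, (hb.map _).prod_eq]

theorem hypergeometric_three_two_eq_five_four {a b c : ℂ}
    (h₁ : 0 < (-3 * a + 2 * b + 2 * c).re) (h₂ : 0 < (-2 * a + 2 * b + 2 * c + 1).re)
    (n₁ : NotNonposInt (-a + 2 * b + c)) (n₂ : NotNonposInt (-a + b + 2 * c))
    (n₃ : NotNonposInt (-(3 * a / 2) + 2 * b + c)) (n₄ : NotNonposInt (-(a / 2) + b + c))
    (n₅ : NotNonposInt (-(5 * a / 2) + 2 * b + 2 * c))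
    (n₆ : NotNonposInt (-(3 * a / 2) + b + 2 * c)) (n₇ : NotNonposInt (-(a / 2) + b + c + 1 / 2))
    (n₈ : NotNonposInt (-(3 * a / 2) + 2 * b + c + 1 / 2))
    (n₉ : NotNonposInt (-2 * a + 2 * b + 2 * c)) (n₁₀ : NotNonposInt (-2 * a + 4 * b + 2 * c)) :
    Summable (hypergeometricTerm [a, b, c] [-a + 2 * b + c, -a + b + 2 * c] 1) ∧
      Summable (hypergeometricTerm
        [-2 * a + 2 * b + 2 * c - 1, c - a / 2, -(3 * a / 2) + b + c, a / 2, b - a / 2]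
        [-(3 * a / 2) + 2 * b + c, -(a / 2) + b + c, -(5 * a / 2) + 2 * b + 2 * c,
          -(3 * a / 2) + b + 2 * c] 1) ∧
      hypergeometricF [a, b, c] [-a + 2 * b + c, -a + b + 2 * c] 1 =
        (Complex.Gamma (-(a / 2) + b + c + 1 / 2) *
            Complex.Gamma (-(3 * a / 2) + 2 * b + c + 1 / 2)) /
          (Complex.Gamma (-a + b + c + 1 / 2) * Complex.Gamma (-a + 2 * b + c + 1 / 2)) *
        ((Complex.Gamma (-a + b + 2 * c) * Complex.Gamma (-3 * a + 2 * b + 2 * c) *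
            Complex.Gamma (-2 * a + 2 * b + 2 * c) * Complex.Gamma (-2 * a + 4 * b + 2 * c)) /
          (Complex.Gamma (-(3 * a / 2) + b + 2 * c) *
            Complex.Gamma (-(5 * a / 2) + 2 * b + 2 * c) *
            Complex.Gamma (-a + 2 * b + 2 * c) * Complex.Gamma (-3 * a + 4 * b + 2 * c))) *
        hypergeometricF
          [-2 * a + 2 * b + 2 * c - 1, c - a / 2, -(3 * a / 2) + b + c, a / 2, b - a / 2]
          [-(3 * a / 2) + 2 * b + c, -(a / 2) + b + c, -(5 * a / 2) + 2 * b + 2 * c,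
            -(3 * a / 2) + b + 2 * c] 1 := by
  -- Passage to `h = b + c - a`, `y = a / 2`, `x = c - a / 2`, which makes the well-poised structure
  -- visible.
  obtain ⟨h, rfl⟩ : ∃ h, b = h - c + a := ⟨b + c - a, by ring⟩
  obtain ⟨y, rfl⟩ : ∃ y, a = 2 * y := ⟨a / 2, by ring⟩
  obtain ⟨x, rfl⟩ : ∃ x, c = x + y := ⟨c - y, by ring⟩
  have e₁ : -(2 * y) + 2 * (h - (x + y) + 2 * y) + (x + y) = 2 * h - x + y := by ring
  have e₂ : -(2 * y) + (h - (x + y) + 2 * y) + 2 * (x + y) = h + x + y := by ring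
  have e₃ : -(3 * (2 * y) / 2) + 2 * (h - (x + y) + 2 * y) + (x + y) = 2 * h - x := by ring
  have e₄ : -(2 * y / 2) + (h - (x + y) + 2 * y) + (x + y) = h + y := by ring
  have e₅ : -(5 * (2 * y) / 2) + 2 * (h - (x + y) + 2 * y) + 2 * (x + y) = 2 * h - y := by ring
  have e₆ : -(3 * (2 * y) / 2) + (h - (x + y) + 2 * y) + 2 * (x + y) = h + x := by ring
  have e₇ : -2 * (2 * y) + 2 * (h - (x + y) + 2 * y) + 2 * (x + y) = 2 * h := by ring
  have e₈ : -2 * (2 * y) + 4 * (h - (x + y) + 2 * y) + 2 * (x + y) = 2 * (2 * h - x + y) := by ring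
  have e₉ : -3 * (2 * y) + 2 * (h - (x + y) + 2 * y) + 2 * (x + y) = 2 * h - 2 * y := by ring
  have e₁₀ : -(2 * y) + (h - (x + y) + 2 * y) + (x + y) = h := by ring
  have e₁₁ : -(2 * y) + 2 * (h - (x + y) + 2 * y) + 2 * (x + y) = 2 * (h + y) := by ring
  have e₁₂ : -3 * (2 * y) + 4 * (h - (x + y) + 2 * y) + 2 * (x + y) = 2 * (2 * h - x) := by ring
  have e₁₃ : x + y - 2 * y / 2 = x := by ring
  have e₁₄ : -(3 * (2 * y) / 2) + (h - (x + y) + 2 * y) + (x + y) = h - y := by ring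
  have e₁₅ : 2 * y / 2 = y := by ring
  have e₁₆ : h - (x + y) + 2 * y - y = h - x := by ring
  have e₁₇ : h - (x + y) + 2 * y = h - x + y := by ring
  rw [e₉] at h₁
  rw [e₇] at h₂ n₉
  rw [e₁] at n₁
  rw [e₂] at n₂
  rw [e₃] at n₃ n₈
  rw [e₄] at n₄ n₇
  rw [e₅] at n₅
  rw [e₆] at n₆
  rw [e₈] at n₁₀
  rw [e₁, e₂, e₃, e₄, e₅, e₆, e₇, e₈, e₉, e₁₀, e₁₁, e₁₂, e₁₃, e₁₄, e₁₅, e₁₆, e₁₇]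
  have H : Admissible h x y :=
    { re_sub := by simp at h₁ ⊢; linarith
      re_half := h₂
      ne_zero := fun h0 => n₉.ne_zero (by rw [h0, mul_zero])
      twoSubAdd := n₁
      addAdd := n₂
      twoSub_left := n₃
      add_left := n₆
      twoSub_right := n₅
      add_right := n₄ }
  have eG : hypergeometricTerm [2 * h - 1, x, h - y, y, h - x]
      [2 * h - x, h + y, 2 * h - y, h + x] 1 = fiveTerm h x y := by
    refine hypergeometricTerm_perm ?_ ?_ 1
    · exact ((List.Perm.swap y (h - y) [h - x]).trans
        (((List.Perm.swap (h - x) (h - y) []).cons y).trans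
          (List.Perm.swap (h - x) y [h - y]))).cons x |>.cons (2 * h - 1)
    · exact ((((List.Perm.swap (h + x) (2 * h - y) []).cons (h + y)).trans
        (List.Perm.swap (h + x) (h + y) [2 * h - y])).trans
        ((List.Perm.swap (2 * h - y) (h + y) []).cons (h + x))).cons (2 * h - x)
  rw [hypergeometricF, hypergeometricF, eG]
  refine ⟨H.summable_threeTerm, H.summable_fiveTerm, ?_⟩
  refine H.tsum_threeTerm_eq.trans ?_
  congr 1
  -- Half of `gammaFactor` is rewritten by duplication; this is the source of the arguments with
  -- `1/2` and of the doubled ones.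
  have d := Gamma_ratio_eq_duplication (s₁ := h) (s₂ := h + y) (s₃ := 2 * h - x + y)
    (s₄ := 2 * h - x) (by ring) n₉ n₁₀ n₄ n₃ n₇ n₈
  calc gammaFactor h x y = Complex.Gamma h * Complex.Gamma (2 * h - x + y) /
        (Complex.Gamma (h + y) * Complex.Gamma (2 * h - x)) *
        (Complex.Gamma (h + x + y) * Complex.Gamma (2 * h - 2 * y) /
          (Complex.Gamma (h + x) * Complex.Gamma (2 * h - y))) := by
        rw [gammaFactor]
        simp only [div_eq_mul_inv, mul_inv]
        ring
    _ = _ := by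
        rw [d]
        simp only [div_eq_mul_inv, mul_inv]
        ring

/-! ### Apéry's approximations to `ζ(2)` -/

theorem factorial_mul_poch (m k : ℕ) :
    (m.factorial : ℂ) * poch ((m : ℂ) + 1) k = ((m + k).factorial : ℂ) := by
  induction k with
  | zero => simp [poch]
  | succ k ih =>
    rw [poch_succ, ← mul_assoc, ih, ← add_assoc, Nat.factorial_succ]
    push_cast
    ring

/-- The summand of the hypergeometric series for Apéry's linear forms in `1` and `ζ(2)`. -/
noncomputable def aperyTerm (m k : ℕ) : ℂ :=
  (m.factorial : ℂ) * ((m + k).factorial : ℂ) ^ 3 /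
    (((2 * m + 1 + k).factorial : ℂ) ^ 2 * (k.factorial : ℂ))

theorem aperyTerm_eq (m k : ℕ) : aperyTerm m k =
    (m.factorial : ℂ) ^ 4 / ((2 * m + 1).factorial : ℂ) ^ 2 *
      hypergeometricTerm [(m : ℂ) + 1, (m : ℂ) + 1, (m : ℂ) + 1]
        [2 * (m : ℂ) + 2, 2 * (m : ℂ) + 2] 1 k := by
  have h1 := factorial_mul_poch (2 * m + 1) k
  rw [show (((2 * m + 1 : ℕ) : ℂ)) + 1 = 2 * m + 2 by push_cast; ring] at h1
  rw [aperyTerm, hypergeometricTerm_three_two, ← factorial_mul_poch m k, ← h1, div_mul_div_comm]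
  congr 1 <;> ring

theorem summable_aperyTerm (m : ℕ) : Summable (aperyTerm m) := by
  rw [funext (aperyTerm_eq m)]
  have hn : NotNonposInt (2 * (m : ℂ) + 2) := notNonposInt_of_re_pos (by simp; positivity)
  refine (summable_hypergeometricTerm rfl (by simpa using hn) ?_).mul_left _
  have : (0 : ℝ) ≤ m := m.cast_nonneg
  simp
  linarith

theorem tendsto_mul_eval {T : ℕ → ℂ} {N : ℕ}
    (hT : ∀ i ≤ N, Tendsto (fun n : ℕ => T n * ((n : ℂ) + 1) ^ i) atTop (𝓝 0))
    {q : Polynomial ℂ} (hq : q.natDegree ≤ N) :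
    Tendsto (fun n : ℕ => T n * q.eval ((n : ℂ) + 1)) atTop (𝓝 0) := by
  have h : Tendsto (fun n : ℕ => ∑ i ∈ Finset.range (N + 1),
      q.coeff i * (T n * ((n : ℂ) + 1) ^ i)) atTop
      (𝓝 (∑ i ∈ Finset.range (N + 1), q.coeff i * 0)) :=
    tendsto_finsetSum _ fun i hi =>
      (hT i (Nat.lt_succ_iff.1 (Finset.mem_range.1 hi))).const_mul _
  simp only [mul_zero, Finset.sum_const_zero] at h
  refine h.congr fun n => ?_
  rw [Polynomial.eval_eq_sum_range' (Nat.lt_succ_of_le hq), Finset.mul_sum]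
  exact Finset.sum_congr rfl fun i _ => by ring

/-- The common factor of the terms in the recurrence for `aperyTerm`. -/
noncomputable def aperyBase (m k : ℕ) : ℂ :=
  (m.factorial : ℂ) * ((m + k).factorial : ℂ) ^ 3 /
    (((2 * m + 5 + k).factorial : ℂ) ^ 2 * (k.factorial : ℂ))

/-- The polynomial certificate of the recurrence for `aperyTerm`. -/
noncomputable def aperyCert (m z : ℂ) : ℂ :=
  (m + 1) * (z ^ 6 + (4 * m + 7) * z ^ 5 - (13 * m ^ 2 + 39 * m + 30) * z ^ 4
    - (102 * m ^ 3 + 482 * m ^ 2 + 758 * m + 397) * z ^ 3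
    - (225 * m ^ 4 + 1416 * m ^ 3 + 3317 * m ^ 2 + 3427 * m + 1317) * z ^ 2
    - (217 * m ^ 5 + 1692 * m ^ 4 + 5217 * m ^ 3 + 7942 * m ^ 2 + 5960 * m + 1760) * z
    - (79 * m ^ 6 + 731 * m ^ 5 + 2779 * m ^ 4 + 5549 * m ^ 3 + 6130 * m ^ 2 + 3548 * m + 840))

/-- With `(2m + 5 + k)!` as common denominator, the terms for `m`, `m + 1`, `m + 2` become
polynomial multiples of one base. -/
theorem aperyTerm_eq_base (m k : ℕ) : aperyTerm m k = aperyBase m k *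
    ((2 * m + 2 + k) * (2 * m + 3 + k) * (2 * m + 4 + k) * (2 * m + 5 + k)) ^ 2 := by
  have f (n : ℕ) : (n.factorial : ℂ) ≠ 0 := by exact_mod_cast n.factorial_ne_zero
  have h : ((2 * m + 5 + k).factorial : ℂ) = (2 * m + 2 + k) * (2 * m + 3 + k) *
      (2 * m + 4 + k) * (2 * m + 5 + k) * (2 * m + 1 + k).factorial := by
    rw [show 2 * m + 5 + k = 2 * m + 1 + k + 1 + 1 + 1 + 1 by ring]
    simp only [Nat.factorial_succ]
    push_cast
    ring
  have h' := f (2 * m + 5 + k)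
  have h1 := f k
  have h2 := f (2 * m + 1 + k)
  rw [h] at h'
  have h3 := left_ne_zero_of_mul h'
  rw [aperyTerm, aperyBase, h]
  generalize (2 * (m : ℂ) + 2 + k) * (2 * m + 3 + k) * (2 * m + 4 + k) * (2 * m + 5 + k) = w at *
  field_simp

theorem aperyTerm_add_one_eq_base (m k : ℕ) : aperyTerm (m + 1) k = aperyBase m k *
    ((m + 1) * (m + 1 + k) ^ 3 * ((2 * m + 4 + k) * (2 * m + 5 + k)) ^ 2) := by
  have f (n : ℕ) : (n.factorial : ℂ) ≠ 0 := by exact_mod_cast n.factorial_ne_zero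
  have h : ((2 * m + 5 + k).factorial : ℂ) = (2 * m + 4 + k) * (2 * m + 5 + k) *
      (2 * (m + 1) + 1 + k).factorial := by
    rw [show 2 * m + 5 + k = 2 * (m + 1) + 1 + k + 1 + 1 by ring]
    simp only [Nat.factorial_succ]
    push_cast
    ring
  have e : ((m + 1 + k).factorial : ℂ) = (m + 1 + k) * (m + k).factorial := by
    rw [show m + 1 + k = m + k + 1 by ring, Nat.factorial_succ]
    push_cast
    ring
  have h' := f (2 * m + 5 + k)
  have h1 := f k
  have h2 := f (2 * (m + 1) + 1 + k)
  rw [h] at h'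
  have h3 := left_ne_zero_of_mul h'
  rw [aperyTerm, aperyBase, h, e, Nat.factorial_succ]
  generalize (2 * (m : ℂ) + 4 + k) * (2 * m + 5 + k) = w at *
  push_cast
  field_simp

theorem aperyTerm_add_two_eq_base (m k : ℕ) : aperyTerm (m + 2) k = aperyBase m k *
    ((m + 1) * (m + 2) * ((m + 1 + k) * (m + 2 + k)) ^ 3) := by
  have e : ((m + 2 + k).factorial : ℂ) = (m + 1 + k) * (m + 2 + k) * (m + k).factorial := by
    rw [show m + 2 + k = m + k + 1 + 1 by ring]
    simp only [Nat.factorial_succ]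
    push_cast
    ring
  have e' : ((m + 2).factorial : ℂ) = (m + 1) * (m + 2) * m.factorial := by
    simp only [Nat.factorial_succ]
    push_cast
    ring
  rw [aperyTerm, aperyBase, e, e', show 2 * (m + 2) + 1 + k = 2 * m + 5 + k by ring]
  ring

theorem aperyBase_succ (m k : ℕ) : aperyBase m (k + 1) * ((k + 1) * (2 * m + 6 + k) ^ 2) =
    aperyBase m k * (m + 1 + k) ^ 3 := by
  have f (n : ℕ) : (n.factorial : ℂ) ≠ 0 := by exact_mod_cast n.factorial_ne_zero
  have h : ((2 * m + 5 + (k + 1)).factorial : ℂ) = (2 * m + 6 + k) * (2 * m + 5 + k).factorial := by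
    rw [← add_assoc, Nat.factorial_succ]
    push_cast
    ring
  have h' : ((k + 1).factorial : ℂ) = (k + 1) * k.factorial := by
    rw [Nat.factorial_succ]
    push_cast
    ring
  have e : ((m + (k + 1)).factorial : ℂ) = (m + 1 + k) * (m + k).factorial := by
    rw [← add_assoc, Nat.factorial_succ]
    push_cast
    ring
  have z1 := f (2 * m + 5 + (k + 1))
  have z2 := f (k + 1)
  have z3 := f k
  have z4 := f (2 * m + 5 + k)
  rw [h] at z1
  rw [h'] at z2
  have z5 := left_ne_zero_of_mul z1
  have z6 := left_ne_zero_of_mul z2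
  rw [aperyBase, aperyBase, h, h', e]
  generalize (2 * (m : ℂ) + 6 + k) = w at *
  generalize (k : ℂ) + 1 = v at *
  field_simp

/-- Zeilberger's recurrence divided by the base term. By `aperyBase_succ` the bracket is the
difference of consecutive certificates, and the factor `k` provides the start at `k = 0`. -/
theorem aperyCert_identity (m k : ℂ) :
    (m + 1) ^ 2 * ((2 * m + 2 + k) * (2 * m + 3 + k) * (2 * m + 4 + k) * (2 * m + 5 + k)) ^ 2 =
      (11 * (m + 1) ^ 2 + 11 * (m + 1) + 3) *
        ((m + 1) * (m + 1 + k) ^ 3 * ((2 * m + 4 + k) * (2 * m + 5 + k)) ^ 2) +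
      (m + 2) ^ 2 * ((m + 1) * (m + 2) * ((m + 1 + k) * (m + 2 + k)) ^ 3) -
      ((m + 1 + k) ^ 3 * aperyCert m (k + 1) - k * (2 * m + 5 + k) ^ 2 * aperyCert m k) := by
  rw [aperyCert, aperyCert]
  ring

theorem tendsto_aperyBase_mul_cert (m : ℕ) :
    Tendsto (fun k : ℕ => aperyBase m k * ((m + 1 + k) ^ 3 * aperyCert m (k + 1))) atTop (𝓝 0) := by
  have hn : NotNonposInt (2 * (m : ℂ) + 6) := notNonposInt_of_re_pos (by simp; positivity)
  have hb (k : ℕ) : aperyBase m k = (m.factorial : ℂ) ^ 4 / ((2 * m + 5).factorial : ℂ) ^ 2 *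
      hypergeometricTerm [(m : ℂ) + 1, (m : ℂ) + 1, (m : ℂ) + 1]
        [2 * (m : ℂ) + 6, 2 * (m : ℂ) + 6] 1 k := by
    have h1 := factorial_mul_poch (2 * m + 5) k
    rw [show (((2 * m + 5 : ℕ) : ℂ)) + 1 = 2 * m + 6 by push_cast; ring] at h1
    rw [aperyBase, hypergeometricTerm_three_two, ← factorial_mul_poch m k, ← h1,
      div_mul_div_comm]
    congr 1 <;> ring
  -- The certificate has degree `3 + 6 = 9` in `k`, and the excess `m + 9` allows every degree below
  -- `m + 10`.
  have hT (i : ℕ) (hi : i ≤ 9) :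
      Tendsto (fun k : ℕ => aperyBase m k * ((k : ℂ) + 1) ^ i) atTop (𝓝 0) := by
    have h := (tendsto_hypergeometricTerm_mul_pow (as := [(m : ℂ) + 1, (m : ℂ) + 1, (m : ℂ) + 1])
      (bs := [2 * (m : ℂ) + 6, 2 * (m : ℂ) + 6]) rfl (by simpa using hn) i ?_).const_mul
      ((m.factorial : ℂ) ^ 4 / ((2 * m + 5).factorial : ℂ) ^ 2)
    · rw [mul_zero] at h
      refine h.congr fun k => ?_
      rw [hb, mul_assoc]
    · have h1 : (0 : ℝ) ≤ m := m.cast_nonneg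
      have h2 : (i : ℝ) ≤ 9 := by exact_mod_cast hi
      simp
      linarith
  obtain ⟨q, hq, hq'⟩ : ∃ q : Polynomial ℂ, q.natDegree ≤ 9 ∧
      ∀ z, q.eval z = (m + z) ^ 3 * aperyCert m z := by
    open Polynomial in
    refine ⟨(C (m : ℂ) + X) ^ 3 * (C ((m : ℂ) + 1) * (X ^ 6 + C (4 * (m : ℂ) + 7) * X ^ 5
      - C (13 * (m : ℂ) ^ 2 + 39 * m + 30) * X ^ 4
      - C (102 * (m : ℂ) ^ 3 + 482 * m ^ 2 + 758 * m + 397) * X ^ 3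
      - C (225 * (m : ℂ) ^ 4 + 1416 * m ^ 3 + 3317 * m ^ 2 + 3427 * m + 1317) * X ^ 2
      - C (217 * (m : ℂ) ^ 5 + 1692 * m ^ 4 + 5217 * m ^ 3 + 7942 * m ^ 2 + 5960 * m + 1760) * X
      - C (79 * (m : ℂ) ^ 6 + 731 * m ^ 5 + 2779 * m ^ 4 + 5549 * m ^ 3 + 6130 * m ^ 2 + 3548 * m
        + 840))), ?_, fun z => ?_⟩
    · compute_degree
    · simp only [eval_mul, eval_pow, eval_add, eval_sub, eval_C, eval_X, aperyCert]
  refine (tendsto_mul_eval hT hq).congr fun k => ?_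
  rw [hq', show (m : ℂ) + (k + 1) = m + 1 + k by ring]

/-- Apéry's recurrence up to the sign of the middle term, which the factor `(-1)^m` in
`tsum_aperyTerm` restores. -/
theorem tsum_aperyTerm_recurrence (m : ℕ) :
    ((m : ℂ) + 1) ^ 2 * ∑' k, aperyTerm m k =
      (11 * ((m : ℂ) + 1) ^ 2 + 11 * ((m : ℂ) + 1) + 3) * ∑' k, aperyTerm (m + 1) k +
        ((m : ℂ) + 2) ^ 2 * ∑' k, aperyTerm (m + 2) k := by
  refine tsum_eq_of_telescoping (summable_aperyTerm m) (summable_aperyTerm (m + 1))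
    (summable_aperyTerm (m + 2)) (tendsto_aperyBase_mul_cert m) ?_ fun j => ?_
  · rw [aperyTerm_eq_base, aperyTerm_add_one_eq_base, aperyTerm_add_two_eq_base]
    have key := aperyCert_identity m 0
    push_cast
    linear_combination aperyBase m 0 * key
  · have hs : aperyBase m j * ((m + 1 + j) ^ 3 * aperyCert m (j + 1)) = aperyBase m (j + 1) *
        (((j + 1 : ℕ) : ℂ) * (2 * m + 5 + (j + 1 : ℕ)) ^ 2 * aperyCert m ((j + 1 : ℕ) : ℂ)) := by
      rw [← mul_assoc, ← aperyBase_succ]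
      push_cast
      ring
    rw [hs, aperyTerm_eq_base, aperyTerm_add_one_eq_base, aperyTerm_add_two_eq_base]
    linear_combination aperyBase m (j + 1) * aperyCert_identity m ((j + 1 : ℕ) : ℂ)

theorem aperyTerm_zero (k : ℕ) : aperyTerm 0 k = 1 / ((k : ℂ) + 1) ^ 2 := by
  have f : (k.factorial : ℂ) ≠ 0 := by exact_mod_cast k.factorial_ne_zero
  have z : (k : ℂ) + 1 ≠ 0 := by exact_mod_cast k.succ_ne_zero
  have e : ((2 * 0 + 1 + k).factorial : ℂ) = (k + 1) * k.factorial := by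
    rw [show 2 * 0 + 1 + k = k + 1 by ring, Nat.factorial_succ]
    push_cast
    ring
  rw [aperyTerm, e]
  simp only [Nat.factorial_zero, Nat.cast_one, zero_add]
  field_simp

theorem aperyTerm_one (k : ℕ) :
    aperyTerm 1 k = ((k : ℂ) + 1) / (((k : ℂ) + 2) ^ 2 * ((k : ℂ) + 3) ^ 2) := by
  have f : (k.factorial : ℂ) ≠ 0 := by exact_mod_cast k.factorial_ne_zero
  have z (n : ℕ) : (k : ℂ) + (n + 1 : ℕ) ≠ 0 := by exact_mod_cast (Nat.succ_ne_zero (k + n))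
  have z1 := z 0
  have z2 := z 1
  have z3 := z 2
  norm_num at z1 z2 z3
  have e : ((2 * 1 + 1 + k).factorial : ℂ) = (k + 3) * (k + 2) * (k + 1) * k.factorial := by
    rw [show 2 * 1 + 1 + k = k + 1 + 1 + 1 by ring]
    simp only [Nat.factorial_succ]
    push_cast
    ring
  have e' : ((1 + k).factorial : ℂ) = (k + 1) * k.factorial := by
    rw [add_comm, Nat.factorial_succ]
    push_cast
    ring
  rw [aperyTerm, e, e', Nat.factorial_one, Nat.cast_one]
  generalize (k : ℂ) + 1 = w₁ at *
  generalize (k : ℂ) + 2 = w₂ at *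
  generalize (k : ℂ) + 3 = w₃ at *
  field_simp

theorem tsum_aperyTerm_zero : ∑' k, aperyTerm 0 k = riemannZeta 2 := by
  have h := zeta_eq_tsum_one_div_nat_add_one_cpow (s := 2) (by norm_num)
  rw [h]
  refine tsum_congr fun k => ?_
  rw [aperyTerm_zero]
  norm_cast

theorem tsum_aperyTerm_one : ∑' k, aperyTerm 1 k = 5 - 3 * riemannZeta 2 := by
  have lim (c : ℕ) : Tendsto (fun n : ℕ => 1 / ((n : ℂ) + c)) atTop (𝓝 0) := by
    have h := (tendsto_const_div_atTop_nhds_zero_nat (1 : ℂ)).comp (tendsto_add_atTop_nat c)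
    refine h.congr fun n => ?_
    simp
  -- Telescoping remainder from partial fractions of the summand plus `3 / (k + 1)^2`. The constant
  -- `5` enters through a series supported at `0`.
  have hV : Tendsto (fun n : ℕ => 3 * (1 / ((n : ℂ) + (3 : ℕ))) + 3 * (1 / ((n : ℂ) + (2 : ℕ))) ^ 2
      + 2 * (1 / ((n : ℂ) + (3 : ℕ))) ^ 2) atTop (𝓝 0) := by
    have := (((lim 3).const_mul 3).add (((lim 2).pow 2).const_mul 3)).add
      (((lim 3).pow 2).const_mul 2)
    simpa using this
  have key := tsum_eq_of_telescoping (p := 1) (a := -3) (b := 5) (t₂ := Pi.single 0 1)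
    (summable_aperyTerm 1) (summable_aperyTerm 0) (hasSum_pi_single 0 1).summable hV
    (by simp [aperyTerm_one, aperyTerm_zero]; norm_num) (fun j => by
      have z (n : ℕ) : (j : ℂ) + (n + 1 : ℕ) ≠ 0 := by exact_mod_cast (Nat.succ_ne_zero (j + n))
      have z2 := z 1
      have z3 := z 2
      have z4 := z 3
      norm_num at z2 z3 z4
      rw [aperyTerm_one, aperyTerm_zero, Pi.single_eq_of_ne (Nat.succ_ne_zero j)]
      push_cast
      rw [show (j : ℂ) + 1 + 1 = j + 2 by ring, show (j : ℂ) + 1 + 2 = j + 3 by ring,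
        show (j : ℂ) + 1 + 3 = j + 4 by ring]
      field_simp
      ring)
  rw [tsum_aperyTerm_zero, (hasSum_pi_single 0 (1 : ℂ)).tsum_eq, one_mul] at key
  rw [key]
  ring

theorem aperySolution_add_two (u₀ u₁ : ℚ) (m : ℕ) :
    ((m : ℂ) + 2) ^ 2 * (aperySolution u₀ u₁ (m + 2) : ℂ) =
      (11 * ((m : ℂ) + 1) ^ 2 + 11 * ((m : ℂ) + 1) + 3) * (aperySolution u₀ u₁ (m + 1) : ℂ) +
        ((m : ℂ) + 1) ^ 2 * (aperySolution u₀ u₁ m : ℂ) := by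
  have z : ((m : ℂ) + 2) ≠ 0 := by exact_mod_cast (Nat.succ_ne_zero (m + 1))
  rw [aperySolution]
  push_cast
  field_simp

theorem tsum_aperyTerm (m : ℕ) : ∑' k, aperyTerm m k =
    (-1) ^ m * ((aperyDen m : ℂ) * riemannZeta 2 - (aperyNum m : ℂ)) := by
  induction m using Nat.twoStepInduction with
  | zero => simp [tsum_aperyTerm_zero, aperyDen, aperyNum, aperySolution]
  | one => simp [tsum_aperyTerm_one, aperyDen, aperyNum, aperySolution]
  | more m ih₀ ih₁ =>
    have z : ((m : ℂ) + 2) ≠ 0 := by exact_mod_cast (Nat.succ_ne_zero (m + 1))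
    have h := tsum_aperyTerm_recurrence m
    have hq := aperySolution_add_two 1 3 m
    have hp := aperySolution_add_two 0 5 m
    rw [ih₀, ih₁] at h
    rw [← aperyDen] at hq
    rw [← aperyNum] at hp
    refine mul_left_cancel₀ (pow_ne_zero 2 z) ?_
    linear_combination -h - (-1) ^ m * (riemannZeta 2 * hq - hp)

/-! ### The well-poised approximations -/

theorem poch_add (a : ℂ) (k l : ℕ) : poch a (k + l) = poch a k * poch (a + k) l := by
  induction l with
  | zero => simp [poch]
  | succ l ih =>
    rw [← add_assoc, poch_succ, ih, poch_succ]
    push_cast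
    ring

theorem admissible_two_mul_add_one (n : ℕ) :
    Admissible (2 * (n : ℂ) + 1) ((n : ℂ) + 1 / 2) ((n : ℂ) + 1 / 2) := by
  have hn : (0 : ℝ) ≤ n := n.cast_nonneg
  have h2 : ((1 : ℂ) / 2).re = 1 / 2 := by norm_num
  constructor
  · simp only [Complex.sub_re, Complex.add_re, h2]; simp; linarith
  · simp; linarith
  · exact_mod_cast (Nat.succ_ne_zero (2 * n))
  all_goals
    refine notNonposInt_of_re_pos ?_
    simp only [Complex.sub_re, Complex.add_re, h2]
    simp
    linarith

theorem threeTerm_two_mul_add_one (n : ℕ) :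
    threeTerm (2 * (n : ℂ) + 1) ((n : ℂ) + 1 / 2) ((n : ℂ) + 1 / 2) =
      hypergeometricTerm [2 * (n : ℂ) + 1, 2 * (n : ℂ) + 1, 2 * (n : ℂ) + 1]
        [4 * (n : ℂ) + 2, 4 * (n : ℂ) + 2] 1 := by
  rw [threeTerm]
  congr 2 <;> ring_nf

theorem fiveTerm_two_mul_add_one (n : ℕ) :
    fiveTerm (2 * (n : ℂ) + 1) ((n : ℂ) + 1 / 2) ((n : ℂ) + 1 / 2) =
      hypergeometricTerm
        [4 * (n : ℂ) + 1, (n : ℂ) + 1 / 2, (n : ℂ) + 1 / 2, (n : ℂ) + 1 / 2, (n : ℂ) + 1 / 2]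
        [3 * (n : ℂ) + 3 / 2, 3 * (n : ℂ) + 3 / 2, 3 * (n : ℂ) + 3 / 2,
          3 * (n : ℂ) + 3 / 2] 1 := by
  rw [fiveTerm]
  congr 2 <;> ring_nf

theorem gammaFactor_two_mul_add_one (n : ℕ) :
    gammaFactor (2 * (n : ℂ) + 1) ((n : ℂ) + 1 / 2) ((n : ℂ) + 1 / 2) =
      Complex.Gamma (4 * n + 2) ^ 2 * Complex.Gamma (2 * n + 1) ^ 2 /
        Complex.Gamma (3 * n + 3 / 2) ^ 4 := by
  rw [gammaFactor, show 2 * (n : ℂ) + 1 + (n + 1 / 2) + (n + 1 / 2) = 4 * n + 2 by ring,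
    show 2 * (n : ℂ) + 1 + (n + 1 / 2) = 3 * n + 3 / 2 by ring,
    show 2 * (2 * (n : ℂ) + 1) - (n + 1 / 2) + (n + 1 / 2) = 4 * n + 2 by ring,
    show 2 * (2 * (n : ℂ) + 1) - (n + 1 / 2) = 3 * n + 3 / 2 by ring,
    show 2 * (2 * (n : ℂ) + 1) - 2 * (n + 1 / 2) = 2 * n + 1 by ring, div_mul_div_comm]
  congr 1 <;> ring

theorem hypergeometricF_three_two_odd (n : ℕ) :
    Complex.Gamma (4 * n + 2) ^ 2 * Complex.Gamma (2 * n + 1) ^ 2 /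
          Complex.Gamma (3 * n + 3 / 2) ^ 4 *
        hypergeometricF
          [4 * (n : ℂ) + 1, (n : ℂ) + 1 / 2, (n : ℂ) + 1 / 2, (n : ℂ) + 1 / 2, (n : ℂ) + 1 / 2]
          [3 * (n : ℂ) + 3 / 2, 3 * (n : ℂ) + 3 / 2, 3 * (n : ℂ) + 3 / 2, 3 * (n : ℂ) + 3 / 2] 1 =
      hypergeometricF [2 * (n : ℂ) + 1, 2 * (n : ℂ) + 1, 2 * (n : ℂ) + 1]
        [4 * (n : ℂ) + 2, 4 * (n : ℂ) + 2] 1 := by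
  have h := (admissible_two_mul_add_one n).tsum_threeTerm_eq
  rw [threeTerm_two_mul_add_one, fiveTerm_two_mul_add_one, gammaFactor_two_mul_add_one] at h
  exact h.symm

theorem wellPoisedR_eq_zero {n t : ℕ} (ht : t < n) : wellPoisedR n ((t : ℂ) + 1) = 0 := by
  have h : ∏ j ∈ Finset.range (4 * n), ((t : ℂ) + 1 - n + j) = 0 := by
    -- The factor with this index is `t + 1 - n + (n - 1 - t) = 0`.
    refine Finset.prod_eq_zero (i := n - 1 - t) (Finset.mem_range.2 (by omega)) ?_
    rw [Nat.cast_sub (by omega), Nat.cast_sub (by omega)]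
    push_cast
    ring
  rw [wellPoisedR, h, mul_zero, zero_div]

/-- Fourth power of the duplication formula at `n + 1/2`; it explains the normalization `2^(8n)
n!^4` and the factor `π²`. -/
theorem Gamma_natCast_add_half (n : ℕ) :
    2 ^ (8 * n) * (n.factorial : ℂ) ^ 4 * Complex.Gamma ((n : ℂ) + 1 / 2) ^ 4 =
      (Real.pi : ℂ) ^ 2 * ((2 * n).factorial : ℂ) ^ 4 := by
  have hd := Complex.Gamma_mul_Gamma_add_half ((n : ℂ) + 1 / 2)
  rw [show (n : ℂ) + 1 / 2 + 1 / 2 = n + 1 by ring, Complex.Gamma_nat_eq_factorial,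
    show 2 * ((n : ℂ) + 1 / 2) = ((2 * n : ℕ) : ℂ) + 1 by push_cast; ring,
    Complex.Gamma_nat_eq_factorial, sub_add_cancel_right, Complex.cpow_neg,
    Complex.cpow_natCast] at hd
  have hp : ((Real.sqrt Real.pi : ℝ) : ℂ) ^ 2 = Real.pi := by
    rw [← Complex.ofReal_pow, Real.sq_sqrt Real.pi_pos.le]
  have h2 : (2 : ℂ) ^ (2 * n) ≠ 0 := pow_ne_zero _ two_ne_zero
  have hd' : 2 ^ (2 * n) * (Complex.Gamma ((n : ℂ) + 1 / 2) * n.factorial) =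
      (2 * n).factorial * (Real.sqrt Real.pi : ℂ) := by
    rw [hd]
    field_simp
  calc _ = (2 ^ (2 * n) * (Complex.Gamma ((n : ℂ) + 1 / 2) * n.factorial)) ^ 4 := by
        rw [show 8 * n = 2 * n * 4 by ring, pow_mul]
        ring
    _ = _ := by
        rw [hd', ← hp]
        ring

/-- After dropping the vanishing summands, numerator and denominator are the Pochhammer symbols `(k
+ 1)_{4n}` and `(n + 1/2 + k)_{2n+1}^4`, which reorganize into the terms of the ₅F₄. -/
theorem wellPoisedR_add (n k : ℕ) : wellPoisedR n (((k + n : ℕ) : ℂ) + 1) =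
    (Real.pi : ℂ) ^ 2 * Complex.Gamma (2 * n + 1) ^ 6 / Complex.Gamma (3 * n + 3 / 2) ^ 4 *
      hypergeometricTerm
        [4 * (n : ℂ) + 1, (n : ℂ) + 1 / 2, (n : ℂ) + 1 / 2, (n : ℂ) + 1 / 2, (n : ℂ) + 1 / 2]
        [3 * (n : ℂ) + 3 / 2, 3 * (n : ℂ) + 3 / 2, 3 * (n : ℂ) + 3 / 2,
          3 * (n : ℂ) + 3 / 2] 1 k := by
  have H := admissible_two_mul_add_one n
  have nh : NotNonposInt ((n : ℂ) + 1 / 2) := by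
    refine notNonposInt_of_re_pos ?_
    have h2 : ((1 : ℂ) / 2).re = 1 / 2 := by norm_num
    simp only [Complex.add_re, h2]
    simp
    positivity
  have nl : NotNonposInt (3 * (n : ℂ) + 3 / 2) := by
    have := H.add_left
    rwa [show 2 * (n : ℂ) + 1 + (n + 1 / 2) = 3 * n + 3 / 2 by ring] at this
  have f (n : ℕ) : (n.factorial : ℂ) ≠ 0 := by exact_mod_cast n.factorial_ne_zero
  have hnum : ∏ j ∈ Finset.range (4 * n), ((((k + n : ℕ) : ℂ) + 1) - n + j) =
      poch ((k : ℂ) + 1) (4 * n) := by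
    rw [← prod_range_add_eq_poch]
    refine Finset.prod_congr rfl fun j _ => ?_
    push_cast
    ring
  have hden : ∏ j ∈ Finset.range (2 * n + 1), ((((k + n : ℕ) : ℂ) + 1) - 1 / 2 + j) ^ 4 =
      poch ((n : ℂ) + 1 / 2 + k) (2 * n + 1) ^ 4 := by
    rw [Finset.prod_pow, ← prod_range_add_eq_poch]
    congr 1
    refine Finset.prod_congr rfl fun j _ => ?_
    push_cast
    ring
  have e1 : (k.factorial : ℂ) * poch ((k : ℂ) + 1) (4 * n) =
      ((4 * n).factorial : ℂ) * poch (4 * (n : ℂ) + 1) k := by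
    have := factorial_mul_poch (4 * n) k
    rw [Nat.cast_mul, Nat.cast_ofNat] at this
    rw [this, factorial_mul_poch, add_comm]
  -- Both sides are `(n + 1/2)_{k + 2n + 1}`, split in the two possible orders.
  have e2 : poch ((n : ℂ) + 1 / 2) k * poch ((n : ℂ) + 1 / 2 + k) (2 * n + 1) =
      poch ((n : ℂ) + 1 / 2) (2 * n + 1) * poch (3 * (n : ℂ) + 3 / 2) k := by
    rw [← poch_add, add_comm k, poch_add]
    congr 2
    push_cast
    ring
  have e3 : Complex.Gamma (3 * n + 3 / 2) =
      Complex.Gamma ((n : ℂ) + 1 / 2) * poch ((n : ℂ) + 1 / 2) (2 * n + 1) := by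
    rw [← Gamma_add_natCast_eq nh]
    congr 1
    push_cast
    ring
  have e4 : Complex.Gamma (2 * n + 1) = ((2 * n).factorial : ℂ) := by
    rw [← Complex.Gamma_nat_eq_factorial]
    push_cast
    rfl
  have e5 := Gamma_natCast_add_half n
  have z1 := poch_ne_zero nh k
  have z2 := poch_ne_zero nh (2 * n + 1)
  have z3 := poch_ne_zero nl k
  have z4 := poch_ne_zero (nh.add_natCast k) (2 * n + 1)
  have z5 := Complex.Gamma_ne_zero nh
  have z6 := f k
  have z7 := f (4 * n)
  rw [wellPoisedR, hnum, hden, hypergeometricTerm_five_four, e3, e4, div_mul_div_comm]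
  generalize poch ((n : ℂ) + 1 / 2 + k) (2 * n + 1) = A at *
  generalize poch ((n : ℂ) + 1 / 2) (2 * n + 1) = B at *
  generalize poch ((n : ℂ) + 1 / 2) k = D at *
  generalize poch (3 * (n : ℂ) + 3 / 2) k = E at *
  generalize poch ((k : ℂ) + 1) (4 * n) = F at *
  generalize poch (4 * (n : ℂ) + 1) k = G at *
  generalize Complex.Gamma ((n : ℂ) + 1 / 2) = J at *
  generalize (k.factorial : ℂ) = Z at *
  generalize ((4 * n).factorial : ℂ) = Y at *
  generalize ((2 * n).factorial : ℂ) = X at *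
  generalize (2 : ℂ) ^ (8 * n) = w at *
  generalize (n.factorial : ℂ) = W at *
  rw [div_eq_div_iff (by positivity) (by positivity)]
  have e2' : D ^ 4 * A ^ 4 = B ^ 4 * E ^ 4 := by rw [← mul_pow, ← mul_pow, e2]
  linear_combination w * W ^ 4 * X ^ 2 * J ^ 4 * B ^ 4 * E ^ 4 * e1 -
    w * W ^ 4 * X ^ 2 * J ^ 4 * Y * G * e2' + X ^ 2 * Y * G * D ^ 4 * A ^ 4 * e5

theorem hasSum_wellPoisedR (n : ℕ) : HasSum (fun t : ℕ => wellPoisedR n ((t : ℂ) + 1))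
    ((Real.pi : ℂ) ^ 2 * Complex.Gamma (2 * n + 1) ^ 6 / Complex.Gamma (3 * n + 3 / 2) ^ 4 *
      hypergeometricF
        [4 * (n : ℂ) + 1, (n : ℂ) + 1 / 2, (n : ℂ) + 1 / 2, (n : ℂ) + 1 / 2, (n : ℂ) + 1 / 2]
        [3 * (n : ℂ) + 3 / 2, 3 * (n : ℂ) + 3 / 2, 3 * (n : ℂ) + 3 / 2,
          3 * (n : ℂ) + 3 / 2] 1) := by
  rw [← hasSum_nat_add_iff' n, Finset.sum_eq_zero fun t ht =>
    wellPoisedR_eq_zero (Finset.mem_range.1 ht), sub_zero]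
  simp only [wellPoisedR_add]
  have hs := (admissible_two_mul_add_one n).summable_fiveTerm
  rw [fiveTerm_two_mul_add_one] at hs
  exact hs.hasSum.mul_left _

theorem wellPoisedForm_eq_three_two (n : ℕ) : wellPoisedForm n =
    (Real.pi : ℂ) ^ 2 * ((2 * n).factorial : ℂ) ^ 4 / ((4 * n + 1).factorial : ℂ) ^ 2 *
      hypergeometricF [2 * (n : ℂ) + 1, 2 * (n : ℂ) + 1, 2 * (n : ℂ) + 1]
        [4 * (n : ℂ) + 2, 4 * (n : ℂ) + 2] 1 := by
  have e1 : Complex.Gamma (2 * n + 1) = ((2 * n).factorial : ℂ) := by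
    rw [← Complex.Gamma_nat_eq_factorial]
    push_cast
    rfl
  have e2 : Complex.Gamma (4 * n + 2) = ((4 * n + 1).factorial : ℂ) := by
    rw [← Complex.Gamma_nat_eq_factorial]
    congr 1
    push_cast
    ring
  have z : ((4 * n + 1).factorial : ℂ) ≠ 0 := by exact_mod_cast (4 * n + 1).factorial_ne_zero
  rw [wellPoisedForm, (hasSum_wellPoisedR n).tsum_eq, ← hypergeometricF_three_two_odd, e1, e2]
  field_simp

theorem wellPoisedForm_eq_apery (n : ℕ) : wellPoisedForm n =
    (Real.pi : ℂ) ^ 2 *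
      ((aperyDen (2 * n) : ℂ) * riemannZeta 2 - (aperyNum (2 * n) : ℂ)) := by
  have h := tsum_aperyTerm (2 * n)
  -- Only even indices `m = 2n` occur, so the sign `(-1)^m` disappears.
  rw [funext (aperyTerm_eq (2 * n)), tsum_mul_left, (even_two_mul n).neg_one_pow, one_mul] at h
  rw [wellPoisedForm_eq_three_two, ← h, hypergeometricF, mul_div_assoc, mul_assoc]
  push_cast
  rw [show 2 * (2 * n) + 1 = 4 * n + 1 by ring, show 2 * (2 * (n : ℂ)) + 2 = 4 * n + 2 by ring]

end

theorem mainTheorem5 :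
    (∀ a b c : ℂ,
      -- convergence of the two series at `1`
      0 < (-3 * a + 2 * b + 2 * c).re →
      0 < (-2 * a + 2 * b + 2 * c + 1).re →
      -- the lower parameters are admissible
      NotNonposInt (-a + 2 * b + c) →
      NotNonposInt (-a + b + 2 * c) →
      NotNonposInt (-(3 * a / 2) + 2 * b + c) →
      NotNonposInt (-(a / 2) + b + c) →
      NotNonposInt (-(5 * a / 2) + 2 * b + 2 * c) →
      NotNonposInt (-(3 * a / 2) + b + 2 * c) →
      -- the Gamma functions in the numerators have no poles
      NotNonposInt (-(a / 2) + b + c + 1 / 2) →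
      NotNonposInt (-(3 * a / 2) + 2 * b + c + 1 / 2) →
      NotNonposInt (-2 * a + 2 * b + 2 * c) →
      NotNonposInt (-2 * a + 4 * b + 2 * c) →
      Summable (hypergeometricTerm [a, b, c] [-a + 2 * b + c, -a + b + 2 * c] 1) ∧
      Summable (hypergeometricTerm
        [-2 * a + 2 * b + 2 * c - 1, c - a / 2, -(3 * a / 2) + b + c, a / 2, b - a / 2]
        [-(3 * a / 2) + 2 * b + c, -(a / 2) + b + c, -(5 * a / 2) + 2 * b + 2 * c,
          -(3 * a / 2) + b + 2 * c] 1) ∧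
      hypergeometricF [a, b, c] [-a + 2 * b + c, -a + b + 2 * c] 1 =
        (Complex.Gamma (-(a / 2) + b + c + 1 / 2) *
            Complex.Gamma (-(3 * a / 2) + 2 * b + c + 1 / 2)) /
          (Complex.Gamma (-a + b + c + 1 / 2) * Complex.Gamma (-a + 2 * b + c + 1 / 2)) *
        ((Complex.Gamma (-a + b + 2 * c) * Complex.Gamma (-3 * a + 2 * b + 2 * c) *
            Complex.Gamma (-2 * a + 2 * b + 2 * c) * Complex.Gamma (-2 * a + 4 * b + 2 * c)) /
          (Complex.Gamma (-(3 * a / 2) + b + 2 * c) *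
            Complex.Gamma (-(5 * a / 2) + 2 * b + 2 * c) *
            Complex.Gamma (-a + 2 * b + 2 * c) * Complex.Gamma (-3 * a + 4 * b + 2 * c))) *
        hypergeometricF
          [-2 * a + 2 * b + 2 * c - 1, c - a / 2, -(3 * a / 2) + b + c, a / 2, b - a / 2]
          [-(3 * a / 2) + 2 * b + c, -(a / 2) + b + c, -(5 * a / 2) + 2 * b + 2 * c,
            -(3 * a / 2) + b + 2 * c] 1) ∧
    (∀ n : ℕ,
      -- the case `a = b = c = 2n + 1`
      Complex.Gamma (4 * n + 2) ^ 2 * Complex.Gamma (2 * n + 1) ^ 2 /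
            Complex.Gamma (3 * n + 3 / 2) ^ 4 *
          hypergeometricF
            [4 * (n : ℂ) + 1, (n : ℂ) + 1 / 2, (n : ℂ) + 1 / 2, (n : ℂ) + 1 / 2, (n : ℂ) + 1 / 2]
            [3 * (n : ℂ) + 3 / 2, 3 * (n : ℂ) + 3 / 2, 3 * (n : ℂ) + 3 / 2, 3 * (n : ℂ) + 3 / 2] 1 =
        hypergeometricF [2 * (n : ℂ) + 1, 2 * (n : ℂ) + 1, 2 * (n : ℂ) + 1]
          [4 * (n : ℂ) + 2, 4 * (n : ℂ) + 2] 1 ∧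
      -- the well-poised approximations `r_n`
      Summable (fun t : ℕ => wellPoisedR n ((t : ℂ) + 1)) ∧
      wellPoisedForm n =
        (Real.pi : ℂ) ^ 2 * Complex.Gamma (2 * n + 1) ^ 6 / Complex.Gamma (3 * n + 3 / 2) ^ 4 *
          hypergeometricF
            [4 * (n : ℂ) + 1, (n : ℂ) + 1 / 2, (n : ℂ) + 1 / 2, (n : ℂ) + 1 / 2, (n : ℂ) + 1 / 2]
            [3 * (n : ℂ) + 3 / 2, 3 * (n : ℂ) + 3 / 2, 3 * (n : ℂ) + 3 / 2, 3 * (n : ℂ) + 3 / 2] 1 ∧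
      wellPoisedForm n =
        (Real.pi : ℂ) ^ 2 * ((2 * n).factorial : ℂ) ^ 4 / ((4 * n + 1).factorial : ℂ) ^ 2 *
          hypergeometricF [2 * (n : ℂ) + 1, 2 * (n : ℂ) + 1, 2 * (n : ℂ) + 1]
            [4 * (n : ℂ) + 2, 4 * (n : ℂ) + 2] 1 ∧
      wellPoisedForm n =
        (Real.pi : ℂ) ^ 2 *
          ((aperyDen (2 * n) : ℂ) * riemannZeta 2 - (aperyNum (2 * n) : ℂ))) := by
  refine ⟨fun a b c h₁ h₂ n₁ n₂ n₃ n₄ n₅ n₆ n₇ n₈ n₉ n₁₀ =>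
    hypergeometric_three_two_eq_five_four h₁ h₂ n₁ n₂ n₃ n₄ n₅ n₆ n₇ n₈ n₉ n₁₀, fun n =>
    ⟨hypergeometricF_three_two_odd n, (hasSum_wellPoisedR n).summable,
      (hasSum_wellPoisedR n).tsum_eq, wellPoisedForm_eq_three_two n, wellPoisedForm_eq_apery n⟩⟩
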